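/- Let $T$ be a first-order theory of fields, possibly with additional structure, and let $A$ be a linear algebraic group that is $0$-definable over $T$: for each model $F$ of $T$ we are given a Zariski closed subgroup $A\le GL_N(F^{alg})$ defined over $F$ (the ideal of polynomials over $F^{alg}$ vanishing on $A$ is generated by polynomials over $F$), cut out of $GL_N$ by polynomial equations of a fixed form whose coefficients are $0$-definable elements of $F$ (defined by one formula for all $F$). Let $H^1(F,A)=H^1(\mathrm{Gal}(F^{sep}/F),A(F^{sep}))$ be the set of continuous $1$-cocycles, $a(st)=a(s)\,s(a(t))$, modulo the relation $a'(s)=b^{-1}a(s)\,s(b)$ for some $b\in A(F^{sep})$. For a finite Galois extension $L/F$ inside $F^{sep}$, $H^1(L/F,A)$ is defined in the same way from $\mathrm{Gal}(L/F)$ and $A(L)$, and for $n\ge 1$ let $H(n;A)(F)\subseteq H^1(F,A)$ be the union of the images of the inflation maps $H^1(L/F,A)\to H^1(F,A)$ over all finite Galois extensions $L/F$ with $[L:F]$ dividing $n$. Then: (1) $H^1(F,A)$ is definable in the pairs $(F,F^{alg})$, uniformly in $F\models T$. That is, there are parameter-free formulas $D(x)$, $E(x,y)$ in the language of pairs (the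 field $F^{alg}$, with a predicate for $F$ and the additional structure on $F$) and, for each $F\models T$, a map $\Phi_F:D(F^{alg})\to H^1(F,A)$ that is surjective and satisfies $\Phi_F(x)=\Phi_F(y)\iff E(x,y)$, so that $D/E$ is in bijection with $H^1(F,A)$. The bijection is canonical in the following sense: for each $d$ there is a parameter-free formula $R_d(x,z)$ which in every $(F,F^{alg})$ says, for $x\in D$, that $z$ codes a cocycle $a:\mathrm{Gal}(L/F)\to A(L)$, for some Galois extension $L/F$ of degree $d$, whose class in $H^1(F,A)$ is $\Phi_F(x)$. Here $z$ codes $a$ if it consists of a generator $\beta$ of $L$ over $F$, a list $(s_i\beta)_{i<d}$ of the conjugates of $\beta$, where $\mathrm{Gal}(L/F)=\{s_i: i<d\}$, and the matrices $(a(s_i))_{i<d}$. (2) There is $n\ge 1$ such that $H^1(F,A)=H(n;A)(F)$ for every model $F$ of $T$; that is, every class in $H^1(F,A)$ comes from $H^1(L/F,A)$ for some Galois extension $L/F$ of degree dividing $n$. -/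

import Mathlib

open FirstOrder FirstOrder.Ring

universe u v w

/-! ### Non-abelian first cohomology -/

namespace GalCoh

noncomputable section

section Cohomology

variable (G : Type*) (M : Type*) [Group G] [TopologicalSpace G] [Group M]
  [MulDistribMulAction G M]

/-- Continuous 1-cocycles of `G` with values in the discrete (possibly non-commutative)
group `M`. -/
structure Cocycle where
  toFun : G → M
  locallyConstant : IsLocallyConstant toFun
  map_mul : ∀ s t : G, toFun (s * t) = toFun s * s • toFun t

/-- Two cocycles are cohomologous if `a' s = b⁻¹ * a s * s • b` for some fixed `b`. -/
def Cohomologous (a a' : Cocycle G M) : Prop :=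
  ∃ b : M, ∀ s : G, a'.toFun s = b⁻¹ * a.toFun s * s • b

theorem cohomologous_equivalence : Equivalence (Cohomologous G M) where
  refl a := ⟨1, fun s => by simp⟩
  symm := by
    rintro a a' ⟨b, hb⟩
    refine ⟨b⁻¹, fun s => ?_⟩
    rw [hb s, smul_inv']
    group
  trans := by
    rintro a a' a'' ⟨b, hb⟩ ⟨c, hc⟩
    refine ⟨b * c, fun s => ?_⟩
    rw [hc s, hb s, smul_mul']
    group

/-- The setoid of cohomologous cocycles. -/
def cocycleSetoid : Setoid (Cocycle G M) := ⟨Cohomologous G M, cohomologous_equivalence G M⟩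

/-- The first cohomology set of `G` with values in `M`. -/
def H1 : Type _ := Quotient (cocycleSetoid G M)

end Cohomology

/-! ### Linear algebraic groups over a field -/

/-- The matrix entries of an element of `GL_N`. -/
def entries {N : ℕ} {E : Type*} [Field E] (g : GL (Fin N) E) : Fin N × Fin N → E :=
  fun ij => g ij.1 ij.2

/-- A linear algebraic group over `F`: a subgroup of `GL_N (F^alg)` which is Zariski closed in
`GL_N` and defined over `F`, that is, the ideal of polynomials over `F^alg` vanishing on it is
generated by polynomials over `F`. -/
structure LinearAlgebraicGroup (F : Type w) [Field F] (N : ℕ) where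
  points : Subgroup (GL (Fin N) (AlgebraicClosure F))
  isClosed : ∀ g : GL (Fin N) (AlgebraicClosure F),
    (∀ p ∈ MvPolynomial.vanishingIdeal (AlgebraicClosure F)
        (entries '' (points : Set (GL (Fin N) (AlgebraicClosure F)))),
      MvPolynomial.aeval (entries g) p = 0) → g ∈ points
  definedOver :
    MvPolynomial.vanishingIdeal (AlgebraicClosure F)
        (entries '' (points : Set (GL (Fin N) (AlgebraicClosure F)))) =
      (MvPolynomial.vanishingIdeal F
        (entries '' (points : Set (GL (Fin N) (AlgebraicClosure F))))).map
          (MvPolynomial.map (algebraMap F (AlgebraicClosure F)))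

namespace LinearAlgebraicGroup

variable {F : Type w} [Field F] {N : ℕ} (A : LinearAlgebraicGroup F N)

/-- The group `A(E)` of `E`-rational points, for a field `F ⊆ E ⊆ F^alg`. -/
def ratPoints (E : Type*) [Field E] [Algebra E (AlgebraicClosure F)] : Subgroup (GL (Fin N) E) :=
  A.points.comap (Matrix.GeneralLinearGroup.map (algebraMap E (AlgebraicClosure F)))

theorem mem_ratPoints_iff (E : Type*) [Field E] [Algebra F E] [Algebra E (AlgebraicClosure F)]
    [IsScalarTower F E (AlgebraicClosure F)] (g : GL (Fin N) E) :
    g ∈ A.ratPoints E ↔ ∀ p ∈ MvPolynomial.vanishingIdeal F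
        (entries '' (A.points : Set (GL (Fin N) (AlgebraicClosure F)))),
      MvPolynomial.aeval (entries g) p = 0 := by
  have key : ∀ p : MvPolynomial (Fin N × Fin N) F,
      MvPolynomial.aeval (entries (Matrix.GeneralLinearGroup.map
        (algebraMap E (AlgebraicClosure F)) g)) p =
      algebraMap E (AlgebraicClosure F) (MvPolynomial.aeval (entries g) p) := by
    intro p
    rw [← MvPolynomial.aeval_algebraMap_apply]
    rfl
  constructor
  · intro hg p hp
    apply (algebraMap E (AlgebraicClosure F)).injective
    rw [← key, map_zero]
    exact hp _ ⟨_, hg, rfl⟩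
  · intro h
    refine A.isClosed _ fun p hp => ?_
    rw [A.definedOver] at hp
    have hle : (MvPolynomial.vanishingIdeal F
        (entries '' (A.points : Set (GL (Fin N) (AlgebraicClosure F))))).map
          (MvPolynomial.map (algebraMap F (AlgebraicClosure F))) ≤
        RingHom.ker (MvPolynomial.aeval (R := AlgebraicClosure F)
          (entries (Matrix.GeneralLinearGroup.map (algebraMap E (AlgebraicClosure F)) g))) := by
      rw [Ideal.map_le_iff_le_comap]
      intro q hq
      rw [Ideal.mem_comap, RingHom.mem_ker, MvPolynomial.aeval_map_algebraMap, key, h q hq,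
        map_zero]
    exact hle hp

section Action

variable (E : Type*) [Field E] [Algebra F E] [Algebra E (AlgebraicClosure F)]
    [IsScalarTower F E (AlgebraicClosure F)]

theorem map_mem_ratPoints (s : Gal(E/F)) {g : GL (Fin N) E} (hg : g ∈ A.ratPoints E) :
    Matrix.GeneralLinearGroup.map (s : E →+* E) g ∈ A.ratPoints E := by
  rw [mem_ratPoints_iff] at hg ⊢
  intro p hp
  have : MvPolynomial.aeval (entries (Matrix.GeneralLinearGroup.map (s : E →+* E) g)) p =
      s (MvPolynomial.aeval (entries g) p) :=
    (MvPolynomial.comp_aeval_apply (φ := (s : E →ₐ[F] E)) (entries g) p).symm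
  rw [this, hg p hp, map_zero]

/-- The Galois group of `E/F` acts on `A(E)` through the matrix entries. -/
instance galAction : MulDistribMulAction Gal(E/F) (A.ratPoints E) where
  smul s g := ⟨Matrix.GeneralLinearGroup.map (s : E →+* E) g.1, A.map_mem_ratPoints E s g.2⟩
  one_smul _ := by ext; rfl
  mul_smul _ _ _ := by ext; rfl
  smul_mul s g h := Subtype.ext (map_mul (Matrix.GeneralLinearGroup.map (s : E →+* E)) g.1 h.1)
  smul_one s := Subtype.ext (map_one (Matrix.GeneralLinearGroup.map (s : E →+* E)))

theorem coe_smul_apply (s : Gal(E/F)) (g : A.ratPoints E) (i j : Fin N) :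
    (s • g : A.ratPoints E).1 i j = s (g.1 i j) := rfl

end Action

/-- `H^1(F, A) = H^1(Gal(F^sep/F), A(F^sep))`, with the Krull topology on the Galois group. -/
abbrev galH1 : Type w := H1 Gal(SeparableClosure F/F) (A.ratPoints (SeparableClosure F))

section Inflation

variable (L : IntermediateField F (SeparableClosure F)) [Normal F L]

/-- The inclusion `A(L) → A(F^sep)`. -/
def inclusion : A.ratPoints L →* A.ratPoints (SeparableClosure F) where
  toFun g := ⟨Matrix.GeneralLinearGroup.map (algebraMap L (SeparableClosure F)) g.1, g.2⟩
  map_one' := Subtype.ext (map_one _)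
  map_mul' g h := Subtype.ext (map_mul _ g.1 h.1)

theorem smul_inclusion (s : Gal(SeparableClosure F/F)) (g : A.ratPoints L) :
    s • A.inclusion L g = A.inclusion L (AlgEquiv.restrictNormalHom L s • g) := by
  ext i j
  exact congrArg Subtype.val (AlgEquiv.restrictNormalHom_apply L s (g.1 i j)).symm

/-- Inflation of cocycles from `Gal(L/F)` to `Gal(F^sep/F)`. -/
def inflCocycle (a : Cocycle Gal(L/F) (A.ratPoints L)) :
    Cocycle Gal(SeparableClosure F/F) (A.ratPoints (SeparableClosure F)) where
  toFun s := A.inclusion L (a.toFun (AlgEquiv.restrictNormalHom L s))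
  locallyConstant :=
    (a.locallyConstant.comp_continuous (InfiniteGalois.restrictNormalHom_continuous L)).comp
      (A.inclusion L)
  map_mul s t := by rw [smul_inclusion, map_mul, a.map_mul, map_mul]

/-- The inflation map `H^1(L/F, A) → H^1(F, A)`. -/
def infl : H1 Gal(L/F) (A.ratPoints L) → A.galH1 :=
  Quotient.map' (s₁ := cocycleSetoid _ _) (s₂ := cocycleSetoid _ _) (A.inflCocycle L) (by
    rintro a a' ⟨b, hb⟩
    refine ⟨A.inclusion L b, fun s => ?_⟩
    change A.inclusion L _ = _ * A.inclusion L _ * _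
    rw [hb, smul_inclusion, map_mul, map_mul, map_inv])

end Inflation

/-- `H(n; A)(F)`: the classes in `H^1(F, A)` in the image of `H^1(L/F, A)` for some finite Galois
extension `L/F` whose degree divides `n`. -/
def splitClasses (n : ℕ) : Set A.galH1 :=
  {ξ | ∃ (L : IntermediateField F (SeparableClosure F)) (_ : FiniteDimensional F L)
    (_ : IsGalois F L), Module.finrank F L ∣ n ∧ ξ ∈ Set.range (A.infl L)}

/-- The tuple `(β, α, m)` codes the cocycle `a ∈ Z(L; A)`, where `[L : F] = d`: `β` generates
`L` over `F`, `α` lists the conjugates `s β` for `s ∈ Gal(L/F)`, and `m i` is the matrix of `a s`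
when `α i = s β`. -/
def Codes {d : ℕ} {L : IntermediateField F (SeparableClosure F)}
    (a : Cocycle Gal(L/F) (A.ratPoints L)) (β : AlgebraicClosure F) (α : Fin d → AlgebraicClosure F)
    (m : Fin d → Fin N → Fin N → AlgebraicClosure F) : Prop :=
  ∃ (b : L) (e : Fin d ≃ Gal(L/F)), IntermediateField.adjoin F {b} = ⊤ ∧
    β = algebraMap L (AlgebraicClosure F) b ∧
    ∀ i, α i = algebraMap L (AlgebraicClosure F) (e i b) ∧
      ∀ j k, m i j k = algebraMap L (AlgebraicClosure F) ((a.toFun (e i)).1 j k)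

end LinearAlgebraicGroup

/-! ### The pair `(F, F^alg)` as a first-order structure -/

/-- Relation symbols on `F^alg`: a predicate for `F`, and the additional structure of `F`, with
functions replaced by their graphs. -/
inductive PairRel (L : FirstOrder.Language.{u, v}) : ℕ → Type (max u v)
  | base : PairRel L 1
  | graph {n : ℕ} (f : L.Functions n) : PairRel L (n + 1)
  | rel {n : ℕ} (r : L.Relations n) : PairRel L n

/-- The language of pairs `(F, F^alg)`, where `F` is a field with additional `L`-structure. -/
def pairLang (L : FirstOrder.Language.{u, v}) : FirstOrder.Language.{0, max u v} :=
  FirstOrder.Language.ring.sum ⟨fun _ => Empty, PairRel L⟩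

/-- Interpretation of the relation symbols in `F^alg`; the additional structure lives on `F`. -/
def pairRelMap (L : FirstOrder.Language.{u, v}) (F : Type w) [Field F] [L.Structure F] :
    {n : ℕ} → PairRel L n → (Fin n → AlgebraicClosure F) → Prop
  | _, .base => fun x => x 0 ∈ Set.range (algebraMap F (AlgebraicClosure F))
  | _, .graph (n := n) f => fun x => ∃ y : Fin n → F,
      x = Fin.snoc (fun i => algebraMap F (AlgebraicClosure F) (y i))
        (algebraMap F (AlgebraicClosure F) (FirstOrder.Language.Structure.funMap f y))
  | _, .rel r => fun x => ∃ y, x = (fun i => algebraMap F (AlgebraicClosure F) (y i)) ∧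
      FirstOrder.Language.Structure.RelMap r y

/-- The pair `(F, F^alg)` as a structure with universe `F^alg`. -/
instance pairStructure (L : FirstOrder.Language.{u, v}) (F : Type w) [Field F] [L.Structure F] :
    (pairLang L).Structure (AlgebraicClosure F) :=
  letI := compatibleRingOfRing (AlgebraicClosure F)
  letI : FirstOrder.Language.Structure ⟨fun _ => Empty, PairRel L⟩ (AlgebraicClosure F) :=
    { funMap := fun f => f.elim
      RelMap := fun r => pairRelMap L F r }
  FirstOrder.Language.sumStructure FirstOrder.Language.ring ⟨fun _ => Empty, PairRel L⟩ (AlgebraicClosure F)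

/-! ### Definability uniformly in the models of a theory of fields -/

/-- A linear algebraic group `0`-definable over the theory `T` of fields with additional
`L`-structure: a linear algebraic group `A_F` over each model `F`, cut out of `GL_N` by fixed
polynomial equations whose coefficients are `0`-definable elements of `F`. -/
structure DefinableGroup {L : FirstOrder.Language.{u, v}} (T : (FirstOrder.Language.ring.sum L).Theory) where
  N : ℕ
  group (F : Type w) [Field F] [CompatibleRing F] [L.Structure F] [F ⊨ T] :
    LinearAlgebraicGroup F N
  uniform : ∃ (m r : ℕ) (θ : (FirstOrder.Language.ring.sum L).Formula (Fin m))
    (f : Fin r → MvPolynomial ((Fin N × Fin N) ⊕ Fin m) ℤ),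
    ∀ (F : Type w) [Field F] [CompatibleRing F] [L.Structure F] [F ⊨ T],
      ∃ c : Fin m → F, (∀ c' : Fin m → F, θ.Realize c' ↔ c' = c) ∧
        ∀ g : GL (Fin N) (AlgebraicClosure F), g ∈ (group F).points ↔
          ∀ j, MvPolynomial.aeval
            (Sum.elim (entries g) (fun i => algebraMap F (AlgebraicClosure F) (c i))) (f j) = 0

/-- Index set for the coordinates of the codes of cocycles of degree `d`. -/
abbrev CodeIdx (N d : ℕ) : Type := Unit ⊕ (Fin d ⊕ (Fin d × Fin N × Fin N))

/-- The tuple of coordinates of a code `(β, α, m)`. -/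
def codeTuple {N d : ℕ} {K : Type*} (β : K) (α : Fin d → K) (m : Fin d → Fin N → Fin N → K) :
    CodeIdx N d → K :=
  Sum.elim (fun _ => β) (Sum.elim α (fun ijk => m ijk.1 ijk.2.1 ijk.2.2))

/-- `H^1(F, A)` is definable in the pairs `(F, F^alg)`, uniformly in the models `F` of `T`: there
are formulas without parameters for a set `D` and an equivalence relation `E` on `D`, and for each
model `F` a bijection `D(F)/E(F) → H^1(F, A)`, induced by `Φ : D(F) → H^1(F, A)`. The bijection is
canonical in that it respects the definable structure coming from cocycles: for each `d` the
relation "`z` codes a cocycle over a Galois extension of degree `d` with class `Φ x`" between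
`x ∈ D(F)` and tuples `z` is defined by one formula `R d`. -/
def H1Definable {L : FirstOrder.Language.{u, v}} {T : (FirstOrder.Language.ring.sum L).Theory}
    (A : DefinableGroup.{u, v, w} T) : Prop :=
  ∃ (k : ℕ) (D : (pairLang L).Formula (Fin k)) (E : (pairLang L).Formula (Fin k ⊕ Fin k))
    (R : ∀ d : ℕ, (pairLang L).Formula (Fin k ⊕ CodeIdx A.N d)),
    ∀ (F : Type w) [Field F] [CompatibleRing F] [L.Structure F] [F ⊨ T],
      ∃ Φ : {x : Fin k → AlgebraicClosure F // D.Realize x} → (A.group F).galH1,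
        Function.Surjective Φ ∧
        (∀ x y, E.Realize (Sum.elim x.1 y.1) ↔ Φ x = Φ y) ∧
        ∀ (d : ℕ) x (β : AlgebraicClosure F) (α : Fin d → AlgebraicClosure F)
          (m : Fin d → Fin A.N → Fin A.N → AlgebraicClosure F),
          (R d).Realize (Sum.elim x.1 (codeTuple β α m)) ↔
            ∃ (L' : IntermediateField F (SeparableClosure F)) (_ : FiniteDimensional F L')
              (_ : IsGalois F L') (a : Cocycle Gal(L'/F) ((A.group F).ratPoints L')),
              (A.group F).Codes a β α m ∧
                (A.group F).infl L' (Quotient.mk (cocycleSetoid _ _) a) = Φ x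

end

end GalCoh

/-! ### Uniform definability in the pairs `(F, F^alg)` -/

/-! Hilbert 90 holds for `GL_N` over F^sep, so every cocycle in A has the form a(s) = g⁻¹ s(g) with
g in GL_N(F^sep). Conversely, g gives a cocycle in A exactly when g⁻¹ s(g) lies in A for all s. Two
such matrices g, g' give the same class iff c g' = g b for some c in GL_N(F) and b in A(F^sep)
(`cohomologous_iff`). Thus H^1(F, A) is a set of matrices modulo a relation that the pair (F, F^alg)
can express, once the condition on g is made first-order. This needs a bound on the degree of a
Galois extension over which a representative lives.

The bound comes from the coset gA. It is stable under Galois, since s(g)A = gA, so its equations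
descend to F: traces of their multiples suffice, because Dedekind independence recovers the original
equations. The exponents of these equations depend only on the form of the equations of A. Any point
of gA over L represents the class by a matrix over L (`exists_bound_twist`). It is therefore enough
that a system with exponents in a fixed finite set which is solvable in F^sep is solvable in a
Galois extension of bounded degree (`exists_bound_finrank`).

For this, suppose fields F_n have systems solvable in F_n^sep but in no Galois extension of degree
at most n. Let k and S be the ultraproducts of the F_n and of the F_n^sep. S need not be algebraic
over k, but MacLane's criterion passes from F_n^sep/F_n to S/k. Hence the field generated over k by
the ultraproduct of the solutions is separable over a purely transcendental extension, and the point
specialises to k^sep. A point over k^sep is given by polynomials in a root of one separable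
polynomial h. Lifted to F_n for almost all n, these data give solutions in degree at most (deg h)!,
a contradiction for large n.

With the bound B, part (2) holds with n = B!. For part (1), D consists of the matrices g with a code
of degree at most B: a generator β, its conjugates α_i, and matrices m_i in A with s_i(g) = g m_i.
Automorphisms are not elements of the structure, but s_i is evaluated by writing an entry as a
polynomial in β over F and substituting α_i. -/

namespace GalCoh

open FirstOrder.Language

/-- A field with additional `L`-structure, bundled. -/
structure FieldModel (L : FirstOrder.Language.{u, v}) where
  F : Type w
  [field : Field F]
  [ring : CompatibleRing F]
  [str : L.Structure F]

attribute [instance] FieldModel.field FieldModel.ring FieldModel.str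

/-- The universe `F^alg` of the pair `(F, F^alg)`. -/
abbrev FieldModel.K {L : FirstOrder.Language.{u, v}} (M : FieldModel.{u, v, w} L) : Type w :=
  AlgebraicClosure M.F

section

variable {L : FirstOrder.Language.{u, v}} {ι κ : Type}

/-- A family of functions on the pairs `(F, F^alg)` given by one term. -/
def UTerm (f : (M : FieldModel.{u, v, w} L) → (ι → M.K) → M.K) : Prop :=
  ∃ t : (pairLang L).Term ι, ∀ (M : FieldModel.{u, v, w} L) (x : ι → M.K), t.realize x = f M x

/-- A family of predicates on the pairs `(F, F^alg)` defined by one formula. -/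
def UDef (P : (M : FieldModel.{u, v, w} L) → (ι → M.K) → Prop) : Prop :=
  ∃ φ : (pairLang L).Formula ι, ∀ (M : FieldModel.{u, v, w} L) (x : ι → M.K),
    φ.Realize x ↔ P M x

namespace UTerm

theorem var (i : ι) : UTerm fun (M : FieldModel.{u, v, w} L) (x : ι → M.K) => x i :=
  ⟨.var i, fun _ _ => rfl⟩

variable {f g : (M : FieldModel.{u, v, w} L) → (ι → M.K) → M.K}

theorem zero : UTerm fun (M : FieldModel.{u, v, w} L) (_ : ι → M.K) => 0 :=
  ⟨.func (l := 0) (Sum.inl zeroFunc) ![], fun _ _ => rfl⟩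

theorem one : UTerm fun (M : FieldModel.{u, v, w} L) (_ : ι → M.K) => 1 :=
  ⟨.func (l := 0) (Sum.inl oneFunc) ![], fun _ _ => rfl⟩

theorem add (hf : UTerm f) (hg : UTerm g) : UTerm fun M x => f M x + g M x := by
  obtain ⟨s, hs⟩ := hf
  obtain ⟨t, ht⟩ := hg
  refine ⟨.func (l := 2) (Sum.inl addFunc) ![s, t], fun M x => ?_⟩
  exact congrArg₂ (· + ·) (hs M x) (ht M x)

theorem mul (hf : UTerm f) (hg : UTerm g) : UTerm fun M x => f M x * g M x := by
  obtain ⟨s, hs⟩ := hf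
  obtain ⟨t, ht⟩ := hg
  refine ⟨.func (l := 2) (Sum.inl mulFunc) ![s, t], fun M x => ?_⟩
  exact congrArg₂ (· * ·) (hs M x) (ht M x)

theorem neg (hf : UTerm f) : UTerm fun M x => - f M x := by
  obtain ⟨s, hs⟩ := hf
  refine ⟨.func (l := 1) (Sum.inl negFunc) ![s], fun M x => ?_⟩
  exact congrArg (- ·) (hs M x)

theorem pow (hf : UTerm f) (n : ℕ) : UTerm fun M x => f M x ^ n := by
  induction n with
  | zero => simpa using one
  | succ n ih => simpa [pow_succ] using ih.mul hf

theorem sum {α : Type*} (s : Finset α)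
    {f : α → (M : FieldModel.{u, v, w} L) → (ι → M.K) → M.K} (hf : ∀ a, UTerm (f a)) :
    UTerm fun M x => ∑ a ∈ s, f a M x := by
  classical
  induction s using Finset.induction_on with
  | empty => simpa using zero
  | insert a s ha ih => simpa [Finset.sum_insert ha] using (hf a).add ih

theorem natCast (n : ℕ) : UTerm fun (M : FieldModel.{u, v, w} L) (_ : ι → M.K) => (n : M.K) := by
  induction n with
  | zero => simpa using zero
  | succ n ih => simpa using ih.add one

theorem intCast (n : ℤ) : UTerm fun (M : FieldModel.{u, v, w} L) (_ : ι → M.K) => (n : M.K) := by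
  obtain ⟨n, rfl | rfl⟩ := n.eq_nat_or_neg
  · simpa using natCast n
  · simpa using (natCast n).neg

theorem aeval {σ : Type} (p : MvPolynomial σ ℤ)
    {f : (M : FieldModel.{u, v, w} L) → (ι → M.K) → σ → M.K}
    (hf : ∀ s, UTerm fun M x => f M x s) :
    UTerm fun M x => MvPolynomial.aeval (f M x) p := by
  induction p using MvPolynomial.induction_on with
  | C a => simpa using intCast a
  | add p q hp hq => simpa using hp.add hq
  | mul_X p s hp => simpa using hp.mul (hf s)

theorem ite (c : Prop) [Decidable c] (hf : UTerm f) (hg : UTerm g) :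
    UTerm fun M x => if c then f M x else g M x := by
  split_ifs
  exacts [hf, hg]

end UTerm

namespace UDef

variable {P Q : (M : FieldModel.{u, v, w} L) → (ι → M.K) → Prop}

theorem eq {f g : (M : FieldModel.{u, v, w} L) → (ι → M.K) → M.K} (hf : UTerm f)
    (hg : UTerm g) : UDef fun M x => f M x = g M x := by
  obtain ⟨s, hs⟩ := hf
  obtain ⟨t, ht⟩ := hg
  refine ⟨s.equal t, fun M x => ?_⟩
  rw [Formula.realize_equal, hs, ht]

theorem and (hP : UDef P) (hQ : UDef Q) : UDef fun M x => P M x ∧ Q M x := by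
  obtain ⟨φ, hφ⟩ := hP
  obtain ⟨ψ, hψ⟩ := hQ
  refine ⟨φ ⊓ ψ, fun M x => ?_⟩
  rw [Formula.realize_inf, hφ, hψ]

theorem imp (hP : UDef P) (hQ : UDef Q) : UDef fun M x => P M x → Q M x := by
  obtain ⟨φ, hφ⟩ := hP
  obtain ⟨ψ, hψ⟩ := hQ
  refine ⟨φ.imp ψ, fun M x => ?_⟩
  rw [Formula.realize_imp, hφ, hψ]

theorem false : UDef fun (M : FieldModel.{u, v, w} L) (_ : ι → M.K) => False :=
  ⟨⊥, fun _ _ => Iff.rfl⟩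

theorem iAnd {α : Type*} [Finite α] {P : α → (M : FieldModel.{u, v, w} L) → (ι → M.K) → Prop}
    (hP : ∀ a, UDef (P a)) : UDef fun M x => ∀ a, P a M x := by
  choose φ hφ using hP
  refine ⟨Formula.iInf φ, fun M x => ?_⟩
  simp only [Formula.realize_iInf, hφ]

theorem iOr {α : Type*} [Finite α] {P : α → (M : FieldModel.{u, v, w} L) → (ι → M.K) → Prop}
    (hP : ∀ a, UDef (P a)) : UDef fun M x => ∃ a, P a M x := by
  choose φ hφ using hP
  refine ⟨Formula.iSup φ, fun M x => ?_⟩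
  simp only [Formula.realize_iSup, hφ]

theorem ex [Finite κ] {P : (M : FieldModel.{u, v, w} L) → (ι → M.K) → (κ → M.K) → Prop}
    (hP : UDef (ι := ι ⊕ κ) fun M x => P M (fun i => x (.inl i)) (fun k => x (.inr k))) :
    UDef fun M x => ∃ y, P M x y := by
  obtain ⟨φ, hφ⟩ := hP
  refine ⟨φ.iExs κ, fun M x => ?_⟩
  simp only [Formula.realize_iExs, hφ]
  rfl

theorem all [Finite κ] {P : (M : FieldModel.{u, v, w} L) → (ι → M.K) → (κ → M.K) → Prop}
    (hP : UDef (ι := ι ⊕ κ) fun M x => P M (fun i => x (.inl i)) (fun k => x (.inr k))) :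
    UDef fun M x => ∀ y, P M x y := by
  obtain ⟨φ, hφ⟩ := hP
  refine ⟨φ.iAlls κ, fun M x => ?_⟩
  simp only [Formula.realize_iAlls, hφ]
  rfl

theorem comp {P : (M : FieldModel.{u, v, w} L) → (κ → M.K) → Prop} (hP : UDef P)
    {f : κ → (M : FieldModel.{u, v, w} L) → (ι → M.K) → M.K} (hf : ∀ k, UTerm (f k)) :
    UDef fun M x => P M fun k => f k M x := by
  obtain ⟨φ, hφ⟩ := hP
  choose t ht using hf
  refine ⟨φ.subst t, fun M x => ?_⟩
  rw [Formula.Realize, BoundedFormula.realize_subst]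
  simp only [ht]
  exact hφ M _

theorem congr (hP : UDef P) (h : ∀ M x, P M x ↔ Q M x) : UDef Q := by
  obtain ⟨φ, hφ⟩ := hP
  exact ⟨φ, fun M x => (hφ M x).trans (h M x)⟩

theorem pairRel {n : ℕ} (r : PairRel L n) :
    UDef fun (M : FieldModel.{u, v, w} L) (x : Fin n → M.K) => pairRelMap L M.F r x :=
  ⟨Relations.formula (L := pairLang L) (Sum.inr r) Term.var, fun _ _ => Formula.realize_rel⟩

theorem base {f : (M : FieldModel.{u, v, w} L) → (ι → M.K) → M.K} (hf : UTerm f) :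
    UDef fun M x => f M x ∈ Set.range (algebraMap M.F M.K) :=
  (pairRel PairRel.base).comp (f := fun _ => f) fun _ => hf

end UDef

/-! ### Relativisation to the base field -/

/-- A family of predicates on fields with additional structure, definable in the pairs. -/
def BaseDef (Q : (M : FieldModel.{u, v, w} L) → (ι → M.F) → Prop) : Prop :=
  ∃ P : (M : FieldModel.{u, v, w} L) → (ι → M.K) → Prop, UDef P ∧
    ∀ (M : FieldModel.{u, v, w} L) (x : ι → M.F), P M (fun i => algebraMap M.F M.K (x i)) ↔ Q M x

namespace BaseDef

variable {P Q : (M : FieldModel.{u, v, w} L) → (ι → M.F) → Prop}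

theorem congr (hP : BaseDef P) (h : ∀ M x, P M x ↔ Q M x) : BaseDef Q := by
  obtain ⟨P', hP', e⟩ := hP
  exact ⟨P', hP', fun M x => (e M x).trans (h M x)⟩

theorem and (hP : BaseDef P) (hQ : BaseDef Q) : BaseDef fun M x => P M x ∧ Q M x := by
  obtain ⟨P', hP', e⟩ := hP
  obtain ⟨Q', hQ', e'⟩ := hQ
  exact ⟨_, hP'.and hQ', fun M x => and_congr (e M x) (e' M x)⟩

theorem imp (hP : BaseDef P) (hQ : BaseDef Q) : BaseDef fun M x => P M x → Q M x := by
  obtain ⟨P', hP', e⟩ := hP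
  obtain ⟨Q', hQ', e'⟩ := hQ
  exact ⟨_, hP'.imp hQ', fun M x => imp_congr (e M x) (e' M x)⟩

theorem iAnd {α : Type*} [Finite α] {P : α → (M : FieldModel.{u, v, w} L) → (ι → M.F) → Prop}
    (hP : ∀ a, BaseDef (P a)) : BaseDef fun M x => ∀ a, P a M x := by
  choose P' hP' e using hP
  exact ⟨_, UDef.iAnd hP', fun M x => forall_congr' fun a => e a M x⟩

theorem comp {P : (M : FieldModel.{u, v, w} L) → (κ → M.F) → Prop} (hP : BaseDef P)
    (f : κ → ι) : BaseDef fun M x => P M fun k => x (f k) := by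
  obtain ⟨P', hP', e⟩ := hP
  exact ⟨_, hP'.comp fun k => UTerm.var (f k), fun M x => e M _⟩

/-- Quantification over F becomes quantification over F^alg bounded by the predicate for F. -/
theorem ex [Finite κ] {P : (M : FieldModel.{u, v, w} L) → (ι → M.F) → (κ → M.F) → Prop}
    (hP : BaseDef (ι := ι ⊕ κ) fun M x => P M (fun i => x (.inl i)) (fun k => x (.inr k))) :
    BaseDef fun M x => ∃ y, P M x y := by
  obtain ⟨P', hP', e⟩ := hP
  refine ⟨fun M x => ∃ y : κ → M.K, (∀ k, y k ∈ Set.range (algebraMap M.F M.K)) ∧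
    P' M (Sum.elim x y), UDef.ex ((UDef.iAnd fun k => UDef.base (UTerm.var _)).and
      (hP'.congr fun M x => iff_of_eq (congrArg _ (Sum.elim_comp_inl_inr x).symm))), ?_⟩
  intro M x
  have key : ∀ y : κ → M.F, P' M (Sum.elim (fun i => algebraMap M.F M.K (x i))
      fun k => algebraMap M.F M.K (y k)) ↔ P M x y := by
    intro y
    refine Iff.trans (iff_of_eq (congrArg _ (funext ?_))) (e M (Sum.elim x y))
    rintro (i | i) <;> rfl
  constructor
  · rintro ⟨y, hy, h⟩
    choose z hz using hy
    obtain rfl := funext hz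
    exact ⟨z, (key z).1 h⟩
  · rintro ⟨y, h⟩
    exact ⟨_, fun k => ⟨y k, rfl⟩, (key y).2 h⟩

theorem all [Finite κ] {P : (M : FieldModel.{u, v, w} L) → (ι → M.F) → (κ → M.F) → Prop}
    (hP : BaseDef (ι := ι ⊕ κ) fun M x => P M (fun i => x (.inl i)) (fun k => x (.inr k))) :
    BaseDef fun M x => ∀ y, P M x y := by
  have hF : BaseDef (ι := ι) fun (M : FieldModel.{u, v, w} L) _ => False :=
    ⟨_, UDef.false, fun _ _ => Iff.rfl⟩
  refine ((ex (P := fun M x y => P M x y → False)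
    (hP.imp (hF.comp Sum.inl))).imp hF).congr fun M x => ?_
  simp only [imp_false, not_exists, not_not]

theorem toUDef [Finite ι] (hQ : BaseDef Q) : UDef fun M x =>
    ∃ c : ι → M.F, (x = fun i => algebraMap M.F M.K (c i)) ∧ Q M c := by
  obtain ⟨P', hP', e⟩ := hQ
  refine ((UDef.iAnd fun j => UDef.base (UTerm.var j)).and hP').congr fun M x => ?_
  constructor
  · rintro ⟨h, h'⟩
    choose c hc using h
    obtain rfl := funext hc
    exact ⟨c, rfl, (e M c).1 h'⟩
  · rintro ⟨c, rfl, h⟩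
    exact ⟨fun j => ⟨c j, rfl⟩, (e M c).2 h⟩

theorem eq (i j : ι) : BaseDef fun (M : FieldModel.{u, v, w} L) (x : ι → M.F) => x i = x j :=
  ⟨_, UDef.eq (UTerm.var i) (UTerm.var j), fun M _ => (algebraMap M.F M.K).injective.eq_iff⟩

/-- Ring operations of F are restrictions of those of F^alg. The additional functions exist in the
pair only through their graphs, which is why the statement concerns the graph and not a term. -/
theorem funMap {n : ℕ} (f : (FirstOrder.Language.ring.sum L).Functions n) :
    BaseDef fun (M : FieldModel.{u, v, w} L) (x : Fin n ⊕ Unit → M.F) =>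
      x (.inr ()) = Structure.funMap f fun i => x (.inl i) := by
  rcases f with f | f
  · have aux : ∀ g : (M : FieldModel.{u, v, w} L) → (Fin n ⊕ Unit → M.K) → M.K, UTerm g →
        (∀ (M : FieldModel.{u, v, w} L) (x : Fin n ⊕ Unit → M.F),
          g M (fun i => algebraMap M.F M.K (x i)) =
            algebraMap M.F M.K (Structure.funMap f fun i => x (.inl i))) →
        BaseDef fun (M : FieldModel.{u, v, w} L) (x : Fin n ⊕ Unit → M.F) =>
          x (.inr ()) = Structure.funMap (L := FirstOrder.Language.ring.sum L) (Sum.inl f)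
            fun i => x (.inl i) := by
      intro g hg h
      refine ⟨_, UDef.eq (UTerm.var (Sum.inr ())) hg, fun M x => ?_⟩
      rw [h]
      exact (algebraMap M.F M.K).injective.eq_iff
    cases f with
    | add => exact aux _ ((UTerm.var (.inl 0)).add (UTerm.var (.inl 1))) fun M x => by simp
    | mul => exact aux _ ((UTerm.var (.inl 0)).mul (UTerm.var (.inl 1))) fun M x => by simp
    | neg => exact aux _ (UTerm.var (.inl 0)).neg fun M x => by simp
    | zero => exact aux _ UTerm.zero fun M x => by simp
    | one => exact aux _ UTerm.one fun M x => by simp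
  · refine ⟨_, (UDef.pairRel (PairRel.graph f)).comp (ι := Fin n ⊕ Unit)
      (f := fun k M x => x (Fin.snoc (α := fun _ => Fin n ⊕ Unit) Sum.inl (Sum.inr ()) k))
      (fun k => UTerm.var _), fun M x => ?_⟩
    constructor
    · rintro ⟨y, hy⟩
      have h1 : ∀ i, x (.inl i) = y i := fun i => (algebraMap M.F M.K).injective <| by
        simpa using congrFun hy i.castSucc
      have h2 := congrFun hy (Fin.last n)
      simp only [Fin.snoc_last] at h2
      refine ((algebraMap M.F M.K).injective h2).trans ?_
      rw [← funext h1]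
      rfl
    · intro h
      refine ⟨fun i => x (.inl i), funext fun k => ?_⟩
      induction k using Fin.lastCases with
      | last => simpa using h
      | cast i => simp

theorem relMap {n : ℕ} (r : (FirstOrder.Language.ring.sum L).Relations n) :
    BaseDef fun (M : FieldModel.{u, v, w} L) (x : Fin n → M.F) => Structure.RelMap r x := by
  rcases r with r | r
  · exact r.elim
  · refine ⟨_, UDef.pairRel (PairRel.rel r), fun M x => ?_⟩
    constructor
    · rintro ⟨y, hy, h⟩
      obtain rfl : x = y := funext fun i => (algebraMap M.F M.K).injective (congrFun hy i)
      exact h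
    · intro h
      exact ⟨x, rfl, h⟩

/-- Nested terms have no counterpart in the pair language, so the values of the subterms are
introduced as existentially quantified elements of F. -/
theorem term (t : (FirstOrder.Language.ring.sum L).Term ι) :
    BaseDef fun (M : FieldModel.{u, v, w} L) (x : ι ⊕ Unit → M.F) =>
      x (.inr ()) = t.realize fun i => x (.inl i) := by
  induction t with
  | var i => exact eq _ _
  | @func n f ts ih =>
    refine (ex (κ := Fin n) (P := fun M x y =>
      (∀ i, y i = (ts i).realize fun a => x (.inl a)) ∧ x (.inr ()) = Structure.funMap f y)
      ((iAnd fun i => ?_).and ?_)).congr fun M x => ?_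
    · exact (ih i).comp (ι := (ι ⊕ Unit) ⊕ Fin n)
        (Sum.elim (fun a => Sum.inl (Sum.inl a)) fun _ => Sum.inr i)
    · exact (funMap f).comp (ι := (ι ⊕ Unit) ⊕ Fin n)
        (Sum.elim (fun a => Sum.inr a) fun _ => Sum.inl (Sum.inr ()))
    · constructor
      · rintro ⟨y, hy, h⟩
        obtain rfl := funext hy
        exact h
      · intro h
        exact ⟨_, fun _ => rfl, h⟩

/-- Relativisation by induction on the formula. It is needed for the formula that isolates the
coefficients of the equations of A inside F. -/
theorem boundedFormula {n : ℕ} (θ : (FirstOrder.Language.ring.sum L).BoundedFormula ι n) :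
    BaseDef fun (M : FieldModel.{u, v, w} L) (x : ι ⊕ Fin n → M.F) =>
      θ.Realize (fun i => x (.inl i)) (fun i => x (.inr i)) := by
  induction θ with
  | falsum => exact ⟨_, UDef.false, fun _ _ => Iff.rfl⟩
  | @equal n s t =>
    refine (ex (κ := Unit) (P := fun M x y => y () = s.realize x ∧ y () = t.realize x)
      ((term s).and (term t))).congr fun M x => ?_
    trans s.realize x = t.realize x
    · exact ⟨fun ⟨y, h, h'⟩ => h.symm.trans h', fun h => ⟨fun _ => _, rfl, h⟩⟩
    · rw [← Sum.elim_comp_inl_inr x]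
      rfl
  | @rel n l r ts =>
    refine (ex (κ := Fin l) (P := fun M x y =>
      (∀ i, y i = (ts i).realize x) ∧ Structure.RelMap r y)
      ((iAnd fun i => ?_).and ?_)).congr fun M x => ?_
    · exact (term (ts i)).comp (ι := (ι ⊕ Fin n) ⊕ Fin l)
        (Sum.elim (fun a => Sum.inl a) fun _ => Sum.inr i)
    · exact (relMap r).comp Sum.inr
    · trans Structure.RelMap r fun i => (ts i).realize x
      · constructor
        · rintro ⟨y, hy, h⟩
          obtain rfl := funext hy
          exact h
        · exact fun h => ⟨_, fun _ => rfl, h⟩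
      · rw [← Sum.elim_comp_inl_inr x]
        rfl
  | imp θ ψ h h' => exact h.imp h'
  | @all n θ ih =>
    refine (all (κ := Unit) (P := fun M x y => θ.Realize (fun i => x (.inl i))
      (Fin.snoc (fun i => x (.inr i)) (y ()))) ?_).congr fun M x => ?_
    · refine (ih.comp (Sum.elim (fun a => .inl (.inl a)) (Fin.snoc (α := fun _ => (ι ⊕ Fin n) ⊕ Unit)
        (fun i => .inl (.inr i)) (.inr ())))).congr fun M x => iff_of_eq (congrArg _ (funext fun k => ?_))
      induction k using Fin.lastCases with
      | last => simp
      | cast i => simp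
    · rw [BoundedFormula.realize_all]
      exact ⟨fun h a => h fun _ => a, fun h y => h (y ())⟩

theorem formula (θ : (FirstOrder.Language.ring.sum L).Formula ι) :
    BaseDef fun (M : FieldModel.{u, v, w} L) (x : ι → M.F) => θ.Realize x := by
  obtain ⟨P, hP, e⟩ := boundedFormula.{u, v, w} θ
  refine ⟨_, hP.comp (ι := ι) (f := fun k M x => Sum.elim x finZeroElim k) ?_, fun M x => ?_⟩
  · rintro (i | i)
    exacts [UTerm.var i, i.elim0]
  · refine Iff.trans (iff_of_eq (congrArg _ (funext ?_))) ((e M (Sum.elim x finZeroElim)).trans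
      (iff_of_eq (congrArg _ (Subsingleton.elim _ _))))
    rintro (i | i)
    exacts [rfl, i.elim0]

end BaseDef

end

end GalCoh

/-! ### Ultraproducts of fields -/

namespace GalCoh

noncomputable section

section Ultra

variable (F : ℕ → Type w) [∀ i, Field (F i)] (U : Ultrafilter ℕ)

/-- The ideal of sequences that vanish almost everywhere. -/
def ultraIdeal : Ideal (∀ i, F i) where
  carrier := {x | ∀ᶠ i in (U : Filter ℕ), x i = 0}
  add_mem' := by
    intro a b ha hb
    filter_upwards [ha, hb] with i h h'
    simp [h, h']
  zero_mem' := Filter.Eventually.of_forall fun _ => rfl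
  smul_mem' := by
    intro c x hx
    filter_upwards [hx] with i h
    simp [h]

instance : (ultraIdeal F U).IsMaximal := by
  rw [Ideal.isMaximal_iff]
  constructor
  · intro h
    have h' : ∀ᶠ i in (U : Filter ℕ), (1 : F i) = 0 := h
    obtain ⟨i, hi⟩ := h'.exists
    exact one_ne_zero hi
  · intro J x hJ hx hxJ
    -- The inverse is taken coordinatewise, with 0⁻¹ = 0. Since U is an ultrafilter, x ∉ `ultraIdeal
    -- F U` means that x is nonzero almost everywhere, where this difference vanishes.
    have h1 : (1 : ∀ i, F i) - x⁻¹ * x ∈ ultraIdeal F U := by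
      have : ∀ᶠ i in (U : Filter ℕ), x i ≠ 0 := Ultrafilter.eventually_not.2 hx
      change ∀ᶠ i in (U : Filter ℕ), _
      filter_upwards [this] with i hi
      simp [hi]
    have := J.add_mem (hJ h1) (J.mul_mem_left x⁻¹ hxJ)
    simpa using this

/-- The ultraproduct of a sequence of fields. -/
abbrev Ultra : Type w := (∀ i, F i) ⧸ ultraIdeal F U

instance : Field (Ultra F U) := Ideal.Quotient.field (ultraIdeal F U)

namespace Ultra

/-- The class of a sequence. -/
def mk : (∀ i, F i) →+* Ultra F U := Ideal.Quotient.mk _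

theorem mk_surjective : Function.Surjective (mk F U) := Ideal.Quotient.mk_surjective

variable {F U}

theorem mk_eq_zero_iff {x : ∀ i, F i} : mk F U x = 0 ↔ ∀ᶠ i in (U : Filter ℕ), x i = 0 :=
  Ideal.Quotient.eq_zero_iff_mem

/-- A polynomial has finitely many coefficients, so the sets where they vanish can be intersected.
Polynomial identities over the ultraproduct pass to almost all factors through this. -/
theorem map_mk_eq_zero_iff {P : Polynomial (∀ i, F i)} : P.map (mk F U) = 0 ↔
    ∀ᶠ i in (U : Filter ℕ), P.map (Pi.evalRingHom F i) = 0 := by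
  constructor
  · intro h
    have h1 : ∀ n ∈ P.support, ∀ᶠ i in (U : Filter ℕ), P.coeff n i = 0 := by
      intro n _
      rw [← mk_eq_zero_iff, ← Polynomial.coeff_map, h, Polynomial.coeff_zero]
    filter_upwards [(Filter.eventually_all_finset P.support).2 h1] with i hi
    ext n
    rw [Polynomial.coeff_map, Polynomial.coeff_zero, Pi.evalRingHom_apply]
    by_cases hn : n ∈ P.support
    · exact hi n hn
    · rw [Polynomial.notMem_support_iff.1 hn, Pi.zero_apply]
  · intro h
    ext n
    rw [Polynomial.coeff_map, Polynomial.coeff_zero, mk_eq_zero_iff]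
    filter_upwards [h] with i hi
    simpa using congrArg (fun p => p.coeff n) hi

variable (E : ℕ → Type w) [∀ i, Field (E i)] [∀ i, Algebra (F i) (E i)]

instance : Algebra (Ultra F U) (Ultra E U) :=
  (Ideal.Quotient.lift (ultraIdeal F U)
    ((mk E U).comp (RingHom.pi fun i => (algebraMap (F i) (E i)).comp (Pi.evalRingHom F i))) (by
      intro a ha
      rw [RingHom.comp_apply, mk_eq_zero_iff]
      have ha : ∀ᶠ i in (U : Filter ℕ), a i = 0 := ha
      filter_upwards [ha] with i hi
      simp [hi])).toAlgebra

theorem algebraMap_mk (x : ∀ i, F i) : algebraMap (Ultra F U) (Ultra E U) (mk F U x) =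
    mk E U fun i => algebraMap (F i) (E i) (x i) := rfl

theorem smul_mk (x : ∀ i, F i) (y : ∀ i, E i) : mk F U x • mk E U y =
    mk E U fun i => x i • y i := by
  rw [Algebra.smul_def, algebraMap_mk, ← map_mul]
  congr 1
  funext i
  exact (Algebra.smul_def _ _).symm

/-- MacLane's criterion passes to ultraproducts. A nontrivial relation among the p-th powers holds
nontrivially in almost all factors. There separability yields a nontrivial relation among the
elements themselves, and these relations assemble to one over the ultraproduct. -/
theorem linearIndependent_pow [∀ i, Algebra.IsSeparable (F i) (E i)] (p : ℕ) (hp : p.Prime)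
    [CharP (Ultra F U) p] {ι : Type*} [Finite ι] {a : ι → Ultra E U}
    (ha : LinearIndependent (Ultra F U) a) :
    LinearIndependent (Ultra F U) fun j => a j ^ p := by
  have := Fintype.ofFinite ι
  have hchar : ∀ᶠ i in (U : Filter ℕ), CharP (F i) p := by
    have : (mk F U) (p : ∀ i, F i) = 0 := by
      rw [map_natCast, CharP.cast_eq_zero]
    filter_upwards [mk_eq_zero_iff.1 this] with i hi
    exact (CharP.charP_iff_prime_eq_zero hp).2 (by simpa using hi)
  choose x hx using fun j => mk_surjective E U (a j)
  obtain rfl := funext hx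
  refine Fintype.linearIndependent_iff.2 fun c hc => ?_
  choose d hd using fun j => mk_surjective F U (c j)
  obtain rfl := funext hd
  by_contra! h
  obtain ⟨j₀, hj₀⟩ := h
  have hj₁ : ∀ᶠ i in (U : Filter ℕ), d j₀ i ≠ 0 :=
    Ultrafilter.eventually_not.2 fun h => hj₀ (mk_eq_zero_iff.2 h)
  have hc' : ∀ᶠ i in (U : Filter ℕ), ∑ j, d j i • x j i ^ p = 0 := by
    simp only [← map_pow, smul_mk, ← map_sum] at hc
    filter_upwards [mk_eq_zero_iff.1 hc] with i hi
    simpa using hi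
  have key : ∀ᶠ i in (U : Filter ℕ), ∃ g : ι → F i, ∑ j, g j • x j i = 0 ∧ ∃ j, g j ≠ 0 := by
    filter_upwards [hchar, hj₁, hc'] with i h1 h2 h3
    by_contra! h4
    have : ExpChar (F i) p := ExpChar.prime hp
    have hli : LinearIndependent (F i) fun j => x j i := Fintype.linearIndependent_iff.2 h4
    have := hli.map_pow_expChar_pow_of_isSeparable p 1
    rw [pow_one, Fintype.linearIndependent_iff] at this
    exact h2 (this _ h3 j₀)
  -- One relation is chosen in each factor; the value 0 at the remaining, negligible indices is
  -- irrelevant.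
  let g : ι → ∀ i, F i := fun j i => by
    classical
    exact if h : ∃ g : ι → F i, ∑ j, g j • x j i = 0 ∧ ∃ j, g j ≠ 0 then h.choose j else 0
  have hg : ∀ᶠ i in (U : Filter ℕ), ∑ j, g j i • x j i = 0 ∧ ∃ j, g j i ≠ 0 := by
    filter_upwards [key] with i hi
    simp only [g, dif_pos hi]
    exact hi.choose_spec
  have ha := Fintype.linearIndependent_iff.1 ha
  have h0 : ∀ j, mk F U (g j) = 0 := by
    refine ha (fun j => mk F U (g j)) ?_
    simp only [smul_mk, ← map_sum]
    rw [mk_eq_zero_iff]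
    filter_upwards [hg] with i hi
    simpa using hi.1
  simp only [mk_eq_zero_iff] at h0
  -- As ι is finite, all coefficients vanish simultaneously at some index where one of them is
  -- nonzero.
  obtain ⟨i, ⟨-, j, hj⟩, h⟩ := (hg.and (Filter.eventually_all.2 h0)).exists
  exact hj (h j)

end Ultra

end Ultra

end

end GalCoh

/-! ### Specialisation of separable points -/

namespace GalCoh

noncomputable section

theorem infinite_of_isSepClosed (E : Type*) [Field E] [IsSepClosed E] : Infinite E := by
  by_contra h
  rw [not_infinite_iff_finite] at h
  -- A finite field is perfect, so separably closed makes it algebraically closed, hence infinite.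
  have : Infinite E := inferInstance
  exact not_finite E

/-- A nonzero polynomial has a nonvanishing point over every infinite extension. -/
theorem exists_aeval_ne_zero {k E σ : Type*} [Field k] [Field E] [Algebra k E] [Infinite E]
    {p : MvPolynomial σ k} (hp : p ≠ 0) : ∃ x : σ → E, MvPolynomial.aeval x p ≠ 0 := by
  by_contra! h
  have : p.map (algebraMap k E) = 0 := MvPolynomial.funext fun x => by
    rw [MvPolynomial.eval_map, map_zero]
    exact h x
  exact hp (MvPolynomial.map_injective _ (algebraMap k E).injective (this.trans (map_zero _).symm))

open Polynomial in
/-- Finitely many elements of a separable extension are polynomials in one element. -/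
theorem exists_eq_aeval_of_isSeparable {k K σ : Type*} [Field k] [Field K] [Algebra k K]
    [Algebra.IsSeparable k K] [Finite σ] (z : σ → K) :
    ∃ (θ : K) (r : σ → k[X]), ∀ s, aeval θ (r s) = z s := by
  have hfd : FiniteDimensional k (IntermediateField.adjoin k (Set.range z)) :=
    IntermediateField.finiteDimensional_adjoin fun x _ => Algebra.IsIntegral.isIntegral x
  obtain ⟨θ, hθ⟩ := Field.exists_primitive_element k (IntermediateField.adjoin k (Set.range z))
  have hr : ∀ s, ∃ r : k[X], aeval (θ : K) r = z s := by
    intro s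
    have h1 : (⟨z s, IntermediateField.subset_adjoin _ _ ⟨s, rfl⟩⟩ :
        IntermediateField.adjoin k (Set.range z)) ∈ IntermediateField.adjoin k {θ} := by
      rw [hθ]; trivial
    rw [← IntermediateField.mem_toSubalgebra,
      IntermediateField.adjoin_simple_toSubalgebra_of_isAlgebraic
        (Algebra.IsIntegral.isIntegral θ).isAlgebraic,
      Algebra.adjoin_singleton_eq_range_aeval] at h1
    obtain ⟨r, hr⟩ := h1
    refine ⟨r, ?_⟩
    have := congrArg (algebraMap _ K) hr
    rw [← RingHom.coe_coe, RingHom.coe_coe] at this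
    exact (Polynomial.aeval_algebraMap_apply _ _ _).trans this
  choose r hr using hr
  exact ⟨θ, r, hr⟩

open scoped IntermediateField.algebraAdjoinAdjoin in
open Polynomial in
-- All coordinates of z are polynomials in one θ, separable over k(t). Inverting one denominator δ
-- in k[t] makes the minimal polynomial of θ, the Bézout identity for its separability and these
-- polynomials integral. Specialising t to a point of E where δ is nonzero keeps the minimal
-- polynomial monic and separable, so it has a root θ' in E, and θ ↦ θ' carries z to the desired
-- point.
theorem exists_specialization_of_separating {k K E σ : Type*} [Field k] [Field K] [Algebra k K]
    [Field E] [Algebra k E] [IsSepClosed E] [Finite σ] {ι : Type*} {t : ι → K}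
    (ht : AlgebraicIndependent k t)
    [Algebra.IsSeparable (IntermediateField.adjoin k (Set.range t)) K] (z : σ → K) :
    ∃ z' : σ → E, ∀ q : MvPolynomial σ k, MvPolynomial.aeval z q = 0 →
      MvPolynomial.aeval z' q = 0 := by
  classical
  have := Fintype.ofFinite σ
  have := infinite_of_isSepClosed E
  set B := Algebra.adjoin k (Set.range t)
  set k' := IntermediateField.adjoin k (Set.range t)
  obtain ⟨θ, r, hr⟩ := exists_eq_aeval_of_isSeparable (k := k') z
  set h := minpoly k' θ
  have hint : IsIntegral k' θ := Algebra.IsIntegral.isIntegral _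
  have hsep : h.Separable := Algebra.IsSeparable.isSeparable k' θ
  obtain ⟨a, b, hab⟩ := hsep
  -- a common denominator for all coefficients
  obtain ⟨δ, hδ⟩ := IsLocalization.exist_integer_multiples_of_finset (nonZeroDivisors B)
    (h.coeffs ∪ a.coeffs ∪ b.coeffs ∪ Finset.univ.biUnion fun s => (r s).coeffs)
  have hδ0 : (δ : B) ≠ 0 := nonZeroDivisors.coe_ne_zero δ
  let R := Localization.Away (δ : B)
  have hu : IsUnit (algebraMap B k' δ) := by
    rw [isUnit_iff_ne_zero]
    exact (map_ne_zero_iff _ (FaithfulSMul.algebraMap_injective B k')).2 hδ0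
  let ψ : R →+* k' := IsLocalization.Away.lift (δ : B) hu
  have hψB : ∀ x, ψ (algebraMap B R x) = algebraMap B k' x := IsLocalization.Away.lift_eq _ hu
  have hψ : Function.Injective ψ := by
    refine (IsLocalization.lift_injective_iff _).2 fun x y => ?_
    rw [(FaithfulSMul.algebraMap_injective B k').eq_iff]
    refine (IsLocalization.injective R (M := Submonoid.powers (δ : B)) ?_).eq_iff
    exact powers_le_nonZeroDivisors_of_noZeroDivisors hδ0
  have hlift : ∀ c ∈ h.coeffs ∪ a.coeffs ∪ b.coeffs ∪ Finset.univ.biUnion fun s => (r s).coeffs,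
      c ∈ Set.range ψ := by
    intro c hc
    obtain ⟨x, hx⟩ := hδ c hc
    refine ⟨IsLocalization.mk' R x (⟨δ, 1, pow_one _⟩ : Submonoid.powers (δ : B)), ?_⟩
    refine (IsLocalization.lift_mk'_spec _ _ _ _).2 ?_
    rw [hx, Algebra.smul_def]
  have hlifts : ∀ p : k'[X], p.coeffs ⊆ h.coeffs ∪ a.coeffs ∪ b.coeffs ∪
      (Finset.univ.biUnion fun s => (r s).coeffs) → p ∈ lifts ψ := by
    intro p hp
    rw [lifts_iff_coeffs_subset_range]
    exact fun c hc => hlift c (hp hc)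
  obtain ⟨h', hh', -, hmon⟩ := lifts_and_natDegree_eq_and_monic
    (hlifts h (by intro c hc; simp [hc])) (minpoly.monic hint)
  obtain ⟨a', ha'⟩ := (mem_lifts _).1 (hlifts a (by intro c hc; simp [hc]))
  obtain ⟨b', hb'⟩ := (mem_lifts _).1 (hlifts b (by intro c hc; simp [hc]))
  have hr' : ∀ s, ∃ r' : R[X], r'.map ψ = r s := fun s => (mem_lifts _).1 <|
    hlifts (r s) (by
      intro c hc
      simp only [Finset.mem_union, Finset.mem_biUnion, Finset.mem_univ, true_and]
      exact Or.inr ⟨s, hc⟩)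
  -- Injectivity of ψ then brings the Bézout identity down to R, so that separability survives every
  -- homomorphism out of R.
  choose r' hr' using hr'
  have hsep' : h'.Separable := by
    refine ⟨a', b', map_injective ψ hψ ?_⟩
    rw [Polynomial.map_add, Polynomial.map_mul, Polynomial.map_mul, ← derivative_map, ha', hb', hh',
      hab, Polynomial.map_one]
  -- specialise the transcendence basis
  have hp : ht.aevalEquiv.symm (δ : B) ≠ 0 := by
    rwa [Ne, EmbeddingLike.map_eq_zero_iff]
  obtain ⟨x, hx⟩ := exists_aeval_ne_zero (E := E) hp
  let φ : B →ₐ[k] E := (MvPolynomial.aeval x).comp ht.aevalEquiv.symm.toAlgHom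
  have hφ : IsUnit ((φ : B →+* E) δ) := isUnit_iff_ne_zero.2 hx
  let Φ : R →+* E := IsLocalization.Away.lift (δ : B) hφ
  have hΦB : ∀ x, Φ (algebraMap B R x) = φ x := IsLocalization.Away.lift_eq _ hφ
  have hdeg : (h'.map Φ).degree ≠ 0 := by
    have h1 : (h'.map Φ).degree = h'.degree := hmon.degree_map Φ
    have h2 : (h'.map ψ).degree = h'.degree := hmon.degree_map ψ
    rw [h1, ← h2, hh']
    exact (minpoly.degree_pos hint).ne'
  obtain ⟨θ', hθ'⟩ := IsSepClosed.exists_root (h'.map Φ) hdeg hsep'.map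
  let i : k →+* R[X] := C.comp ((algebraMap B R).comp (algebraMap k B))
  refine ⟨fun s => (r' s |>.map Φ).eval θ', fun q hq => ?_⟩
  let P : R[X] := MvPolynomial.eval₂ i r' q
  have hP1 : aeval θ (P.map ψ) = 0 := by
    rw [← hq, MvPolynomial.aeval_def, ← coe_mapRingHom, MvPolynomial.hom_eval₂,
      ← RingHom.coe_coe (aeval θ), MvPolynomial.hom_eval₂]
    congr 1
    · ext c
      simp [i, hψB]
      rfl
    · funext s
      simp [hr', hr]
  -- Divisibility holds over k(t) by minimality and descends along the injective ψ because h' is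
  -- monic; this keeps the quotient within R.
  have hP2 : h' ∣ P := by
    rw [← map_dvd_map ψ hψ hmon, hh']
    exact minpoly.dvd _ _ hP1
  have hP3 : (P.map Φ).eval θ' = 0 := by
    obtain ⟨w, hw⟩ := hP2
    rw [hw, Polynomial.map_mul, eval_mul, hθ'.eq_zero, zero_mul]
  rw [← hP3, MvPolynomial.aeval_def, ← coe_mapRingHom, MvPolynomial.hom_eval₂,
    ← coe_evalRingHom, MvPolynomial.hom_eval₂]
  congr 1
  ext c
  simp [i, hΦB]

end

end GalCoh

/-! ### MacLane's criterion and solutions of bounded degree -/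

namespace GalCoh

noncomputable section

/-- If `S/k` satisfies MacLane's criterion, every point over `S` specialises to a point over
each separably closed extension of `k`. -/
theorem exists_specialization {k S E σ : Type*} [Field k] [Field S] [Algebra k S]
    [Field E] [Algebra k E] [IsSepClosed E] [Finite σ]
    (H : ∀ p : ℕ, p.Prime → CharP k p → ∀ s : Finset S, LinearIndepOn k id (s : Set S) →
      LinearIndepOn k (· ^ p) (s : Set S)) (z : σ → S) :
    ∃ z' : σ → E, ∀ q : MvPolynomial σ k, MvPolynomial.aeval z q = 0 →
      MvPolynomial.aeval z' q = 0 := by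
  classical
  let K := IntermediateField.adjoin k (Set.range z)
  have hfg : Algebra.EssFiniteType k K := IntermediateField.essFiniteType_iff.2
    (IntermediateField.fg_def.2 ⟨_, Set.finite_range z, rfl⟩)
  -- Only the finitely generated subfield k(z) needs a separating transcendence basis. In
  -- characteristic 0 it exists because k is perfect; in characteristic p the criterion is inherited
  -- from S.
  have hK : ∃ s : Finset K, IsTranscendenceBasis k ((↑) : s → K) ∧
      Algebra.IsSeparable (IntermediateField.adjoin k (s : Set K)) K := by
    obtain _ | ⟨p, hp, hpk⟩ := CharP.exists' k
    · exact exists_isTranscendenceBasis_and_isSeparable_of_perfectField k K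
    · refine exists_isTranscendenceBasis_and_isSeparable_of_linearIndepOn_pow_of_essFiniteType
        p hp.out fun s hs => ?_
      let s' : Finset S := Finset.image (algebraMap K S) s
      have h1 : LinearIndepOn k id (s' : Set S) := by
        rw [Finset.coe_image]
        exact (hs.map_injOn (Algebra.linearMap K S |>.restrictScalars k)
          (algebraMap K S).injective.injOn).id_image
      have h2 := H p hp.out hpk _ h1
      let f : ↥(s : Set K) → ↥(s' : Set S) := fun x =>
        ⟨algebraMap K S x.1, Finset.mem_coe.2 (Finset.mem_image_of_mem _ (Finset.mem_coe.1 x.2))⟩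
      have hf : Function.Injective f := by
        intro x y hxy
        have h0 : (f x).1 = (f y).1 := by rw [hxy]
        exact Subtype.ext ((algebraMap K S).injective h0)
      have h3 : LinearIndependent k fun x : (s : Set K) => K.val.toLinearMap (x.1 ^ p) :=
        LinearIndependent.comp h2 f hf
      exact LinearIndependent.of_comp K.val.toLinearMap h3
  obtain ⟨s, hs, hsep⟩ := hK
  have hsep' : Algebra.IsSeparable
      (IntermediateField.adjoin k (Set.range ((↑) : s → K))) K := by
    convert! hsep <;> simp
  let z₁ : σ → K := fun s => ⟨z s, IntermediateField.subset_adjoin _ _ ⟨s, rfl⟩⟩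
  obtain ⟨z', hz'⟩ := exists_specialization_of_separating (E := E) hs.1 z₁
  refine ⟨z', fun q hq => hz' q ?_⟩
  apply (algebraMap K S).injective
  rw [map_zero, ← hq]
  exact (MvPolynomial.aeval_algebraMap_apply S z₁ q).symm

open Polynomial in
/-- A separable polynomial of degree `e > 0` has a root in a Galois extension of degree at most
`e!`. -/
theorem exists_galois_root {F : Type*} [Field F] {h : F[X]} (hsep : h.Separable)
    (hdeg : h.natDegree ≠ 0) :
    ∃ (L : IntermediateField F (SeparableClosure F)) (_ : FiniteDimensional F L)
      (_ : IsGalois F L) (θ : L), Module.finrank F L ≤ h.natDegree.factorial ∧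
        aeval θ h = 0 := by
  have hsp : (h.map (algebraMap F (SeparableClosure F))).Splits :=
    IsSepClosed.splits_codomain _ hsep
  let L := IntermediateField.adjoin F (h.rootSet (SeparableClosure F))
  have hL : h.IsSplittingField F L := IntermediateField.adjoin_rootSet_isSplittingField hsp
  have hfd : FiniteDimensional F L := IsSplittingField.finiteDimensional L h
  have hG : IsGalois F L := IsGalois.of_separable_splitting_field hsep
  obtain ⟨θ, hθ⟩ := hL.splits.exists_eval_eq_zero (by
    rw [degree_map]
    exact fun h0 => hdeg (natDegree_eq_of_degree_eq_some h0))
  refine ⟨L, hfd, hG, θ, ?_, by rwa [eval_map_algebraMap] at hθ⟩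
  rw [(IsSplittingField.algEquiv L h).toLinearEquiv.finrank_eq, ← Gal.card_of_separable hsep]
  have : Fact ((h.map (algebraMap F (SeparableClosure F))).Splits) := ⟨hsp⟩
  -- The Galois group of the splitting field acts faithfully on the roots, whose number is the
  -- degree.
  refine (Nat.card_le_card_of_injective _ (Gal.galActionHom_injective h
    (SeparableClosure F))).trans ?_
  rw [Nat.card_perm, Nat.card_eq_fintype_card, card_rootSet_eq_natDegree hsep hsp]

open Polynomial in
/-- Systems of polynomial equations with exponents in a fixed finite set, if they are solvable in
the separable closure, are solvable in a Galois extension of bounded degree. -/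
theorem exists_bound_finrank {σ : Type*} [Finite σ] (m : Finset (σ →₀ ℕ)) :
    ∃ B : ℕ, ∀ (F : Type w) [Field F] (W : Set (MvPolynomial σ F)),
      (∀ q ∈ W, q.support ⊆ m) →
      (∃ z : σ → SeparableClosure F, ∀ q ∈ W, MvPolynomial.aeval z q = 0) →
      ∃ (L : IntermediateField F (SeparableClosure F)) (_ : FiniteDimensional F L)
        (_ : IsGalois F L) (z : σ → L), Module.finrank F L ≤ B ∧
          ∀ q ∈ W, MvPolynomial.aeval z q = 0 := by
  classical
  by_contra! hcon
  -- For each n, a counterexample to the bound B = n.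
  choose F hF W hW hz hbad using hcon
  choose z hz using hz
  let U : Ultrafilter ℕ := Filter.hyperfilter ℕ
  let E : ℕ → Type w := fun n => SeparableClosure (F n)
  let k := Ultra F U
  let S := Ultra E U
  let zS : σ → S := fun s => Ultra.mk E U fun n => z n s
  obtain ⟨z', hz'⟩ := exists_specialization (k := k) (S := S) (E := SeparableClosure k)
    (fun p hp hc s hs => Ultra.linearIndependent_pow E p hp hs) zS
  obtain ⟨θ, r, hr⟩ := exists_eq_aeval_of_isSeparable (k := k) z'
  have hint : IsIntegral k θ := Algebra.IsIntegral.isIntegral _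
  obtain ⟨a, b, hab⟩ : (minpoly k θ).Separable := Algebra.IsSeparable.isSeparable k θ
  have hlift : ∀ p : k[X], ∃ p' : (∀ n, F n)[X], p'.map (Ultra.mk F U) = p :=
    Polynomial.map_surjective _ (Ultra.mk_surjective F U)
  obtain ⟨h', hh', hdeg, hmon⟩ := lifts_and_natDegree_eq_and_monic
    ((mem_lifts _).2 (hlift (minpoly k θ))) (minpoly.monic hint)
  obtain ⟨a', ha'⟩ := hlift a
  obtain ⟨b', hb'⟩ := hlift b
  choose r' hr' using fun s => hlift (r s)
  have hsep : ∀ᶠ n in (U : Filter ℕ), (h'.map (Pi.evalRingHom F n)).Separable := by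
    have h0 : (a' * h' + b' * derivative h' - 1).map (Ultra.mk F U) = 0 := by
      rw [Polynomial.map_sub, Polynomial.map_add, Polynomial.map_mul, Polynomial.map_mul,
        ← derivative_map, ha', hb', hh', hab, Polynomial.map_one, sub_self]
    filter_upwards [Ultra.map_mk_eq_zero_iff.1 h0] with n hn
    rw [Polynomial.map_sub, Polynomial.map_add, Polynomial.map_mul, Polynomial.map_mul,
        ← derivative_map, Polynomial.map_one, sub_eq_zero] at hn
    exact ⟨_, _, hn⟩
  let red : ∀ n, MvPolynomial σ (F n) → (F n)[X] := fun n q =>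
    MvPolynomial.aeval (fun s => (r' s).map (Pi.evalRingHom F n)) q
  -- The set of indices must serve all equations of W n at once, although W n may be infinite. So
  -- one failing equation per index is collected into a single polynomial over the ultraproduct.
  have hdvd : ∀ᶠ n in (U : Filter ℕ), ∀ q ∈ W n, h'.map (Pi.evalRingHom F n) ∣ red n q := by
    by_contra hnot
    rw [← Ultrafilter.eventually_not] at hnot
    have hex : ∀ n, ∃ q : MvPolynomial σ (F n), q.support ⊆ m ∧
        MvPolynomial.aeval (z n) q = 0 ∧
        ((¬ ∀ q ∈ W n, h'.map (Pi.evalRingHom F n) ∣ red n q) →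
          ¬ h'.map (Pi.evalRingHom F n) ∣ red n q) := by
      intro n
      by_cases hn : ∀ q ∈ W n, h'.map (Pi.evalRingHom F n) ∣ red n q
      · exact ⟨0, by simp, by simp, fun h => (h hn).elim⟩
      · push Not at hn
        obtain ⟨q, hq, hq'⟩ := hn
        exact ⟨q, hW n q hq, hz n q hq, fun _ => hq'⟩
    choose q hqm hqz hq using hex
    -- The sequence of the q n is a polynomial over the product ring only because all exponents lie
    -- in the finite set m.
    let Q : MvPolynomial σ (∀ n, F n) :=
      ∑ e ∈ m, MvPolynomial.monomial e fun n => (q n).coeff e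
    have hQ : ∀ n, Q.map (Pi.evalRingHom F n) = q n := by
      intro n
      simp only [Q, map_sum, MvPolynomial.map_monomial, Pi.evalRingHom_apply]
      conv_rhs => rw [(q n).as_sum]
      symm
      refine Finset.sum_subset (hqm n) fun e _ he => ?_
      rw [MvPolynomial.notMem_support_iff.1 he, MvPolynomial.monomial_zero]
    have hQz : MvPolynomial.aeval zS (Q.map (Ultra.mk F U)) = 0 := by
      let j : (∀ n, F n) →+* ∀ n, E n :=
        RingHom.pi fun n => (algebraMap (F n) (E n)).comp (Pi.evalRingHom F n)
      have h1 : MvPolynomial.aeval zS (Q.map (Ultra.mk F U)) =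
          Ultra.mk E U (MvPolynomial.eval₂ j (fun s n => z n s) Q) := by
        rw [MvPolynomial.aeval_def, MvPolynomial.eval₂_map, MvPolynomial.hom_eval₂]
        rfl
      rw [h1]
      convert! map_zero (Ultra.mk E U)
      funext n
      refine (MvPolynomial.hom_eval₂ Q j (Pi.evalRingHom E n) fun s n => z n s).trans ?_
      rw [Pi.zero_apply, ← hqz n, ← hQ n, MvPolynomial.aeval_def, MvPolynomial.eval₂_map]
      rfl
    have hQr : minpoly k θ ∣ MvPolynomial.aeval r (Q.map (Ultra.mk F U)) := by
      refine minpoly.dvd _ _ ?_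
      rw [← hz' _ hQz, MvPolynomial.comp_aeval_apply]
      simp only [hr]
    obtain ⟨t, ht⟩ := hQr
    obtain ⟨t', rfl⟩ := hlift t
    have h0 : (MvPolynomial.eval₂ C r' Q - h' * t').map (Ultra.mk F U) = 0 := by
      rw [Polynomial.map_sub, Polynomial.map_mul, hh', ← ht, MvPolynomial.aeval_def,
        ← coe_mapRingHom, MvPolynomial.hom_eval₂, MvPolynomial.eval₂_map, sub_eq_zero]
      congr 1
      · refine RingHom.ext fun c => ?_
        simp
        rfl
      · funext s
        exact hr' s
    obtain ⟨n, hn, hn'⟩ := ((Ultra.map_mk_eq_zero_iff.1 h0).and hnot).exists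
    refine hq n hn' ⟨t'.map (Pi.evalRingHom F n), ?_⟩
    rw [Polynomial.map_sub, Polynomial.map_mul, sub_eq_zero] at hn
    rw [← hn, ← coe_mapRingHom, MvPolynomial.hom_eval₂]
    simp only [red]
    rw [← hQ n, MvPolynomial.aeval_def, MvPolynomial.eval₂_map]
    congr 1
    ext c : 1
    simp
  have hlarge : ∀ᶠ n in (U : Filter ℕ), h'.natDegree.factorial ≤ n :=
    Nat.hyperfilter_le_atTop (Filter.eventually_ge_atTop _)
  obtain ⟨n, h1, h2, h3⟩ := (hsep.and (hdvd.and hlarge)).exists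
  have hdn : (h'.map (Pi.evalRingHom F n)).natDegree = h'.natDegree := hmon.natDegree_map _
  obtain ⟨L, hL, hG, η, hfin, hη⟩ := exists_galois_root h1
    (by rw [hdn, hdeg]; exact (minpoly.natDegree_pos hint).ne')
  obtain ⟨q, hq, hq'⟩ := hbad n L hL hG
    (fun s => aeval η ((r' s).map (Pi.evalRingHom F n)))
    ((hfin.trans (congrArg Nat.factorial hdn).le).trans h3)
  refine hq' ?_
  rw [← MvPolynomial.comp_aeval_apply]
  obtain ⟨t, ht⟩ := h2 q hq
  exact (congrArg (aeval η) ht).trans (by rw [map_mul, hη, zero_mul])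

end

end GalCoh

/-! ### Hilbert 90 for `GL_N` -/

namespace GalCoh

noncomputable section

open Matrix

variable {F : Type w} [Field F] {N : ℕ}

/-- Dedekind's independence of the automorphisms of a finite extension, with coefficients in a
larger field. -/
theorem eq_zero_of_sum_galois_eq_zero {L Ω : Type*} [Field L] [Algebra F L] [Field Ω]
    [Algebra L Ω] [FiniteDimensional F L] {c : Gal(L/F) → Ω}
    (h : ∀ x : L, ∑ s, algebraMap L Ω (s x) * c s = 0) (s : Gal(L/F)) : c s = 0 := by
  let χ : Gal(L/F) → L →* Ω := fun s => ((algebraMap L Ω).comp (s : L →+* L)).toMonoidHom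
  have hχ : Function.Injective χ := fun s t hst => by
    ext x
    exact (algebraMap L Ω).injective (DFunLike.congr_fun hst x)
  refine Fintype.linearIndependent_iff.1 ((linearIndependent_monoidHom L Ω).comp χ hχ) c ?_ s
  funext x
  simpa [χ, mul_comm] using h x

/-- The action of an automorphism on `GL_N`. -/
abbrev galMap {E : Type*} [Field E] [Algebra F E] (s : Gal(E/F)) :
    GL (Fin N) E →* GL (Fin N) E :=
  Matrix.GeneralLinearGroup.map (s : E →+* E)

/-- The averages of the columns of a over a finite quotient of the Galois group are fixed by the
twisted action v ↦ a(s) s(v). By Dedekind independence they span Ω^N, so N of them form an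
invertible P with a(s) s(P) = P, and P⁻¹ is the required matrix. -/
theorem hilbert90 {Ω : Type*} [Field Ω] [Algebra F Ω] [IsGalois F Ω]
    (a : Gal(Ω/F) → GL (Fin N) Ω) (hc : IsLocallyConstant a)
    (hm : ∀ s t, a (s * t) = a s * galMap s (a t)) :
    ∃ g : GL (Fin N) Ω, ∀ s, g * a s = galMap s g := by
  classical
  have h1 : a 1 = 1 := by
    have := hm 1 1
    rw [mul_one] at this
    have h2 : galMap (1 : Gal(Ω/F)) (a 1) = a 1 := by ext; rfl
    rw [h2] at this
    exact left_eq_mul.1 this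
  have hnhd : a ⁻¹' {1} ∈ nhds (1 : Gal(Ω/F)) := (hc.isOpen_fiber 1).mem_nhds h1
  obtain ⟨L, hLf, hLn, hL⟩ := (krullTopology_mem_nhds_one_iff_of_normal F Ω _).1 hnhd
  have hLg : IsGalois F L := ⟨⟩
  -- By continuity, a is trivial on the automorphisms fixing some finite normal L, so it depends
  -- only on the restriction to L.
  have hfix : ∀ s t : Gal(Ω/F), AlgEquiv.restrictNormalHom L s = AlgEquiv.restrictNormalHom L t →
      a s = a t := by
    intro s t hst
    have h3 : a (s⁻¹ * t) = 1 := by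
      refine hL fun x => ?_
      have h4 : AlgEquiv.restrictNormalHom L (s⁻¹ * t) = 1 := by
        rw [map_mul, map_inv, hst, inv_mul_cancel]
      have h5 := AlgEquiv.restrictNormalHom_apply L (s⁻¹ * t) x
      rw [h4] at h5
      exact h5.symm
    have := hm s (s⁻¹ * t)
    rw [mul_inv_cancel_left, h3, map_one, mul_one] at this
    exact this.symm
  choose l hl using AlgEquiv.restrictNormalHom_surjective (F := F) (K₁ := L) Ω
  let p : L → Fin N → Fin N → Ω := fun x j =>
    ∑ s : Gal(L/F), (algebraMap L Ω (s x)) • fun i => (a (l s)) i j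
  have hp : ∀ (s : Gal(Ω/F)) x j, (a s).1 *ᵥ (fun i => s (p x j i)) = p x j := by
    intro s x j
    have h5 : ∀ t, a (l (AlgEquiv.restrictNormalHom L s * t)) = a s * galMap s (a (l t)) := by
      intro t
      rw [← hm]
      exact hfix _ _ (by rw [hl, map_mul, hl])
    have h6 : (fun i => s (p x j i)) = ∑ t : Gal(L/F),
        algebraMap L Ω ((AlgEquiv.restrictNormalHom L s * t) x) •
          fun i => galMap s (a (l t)) i j := by
      funext i
      simp only [p, Finset.sum_apply, Pi.smul_apply, smul_eq_mul, map_sum, map_mul]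
      refine Finset.sum_congr rfl fun t _ => ?_
      congr 1
      exact (AlgEquiv.restrictNormalHom_apply L s (t x)).symm
    rw [h6, Matrix.mulVec_sum]
    refine Fintype.sum_equiv (Equiv.mulLeft (AlgEquiv.restrictNormalHom L s)) _ _ fun t => ?_
    rw [Matrix.mulVec_smul, Equiv.coe_mulLeft, h5]
    rfl
  -- A functional killing every average kills, by Dedekind, each column of every a (l s); one of
  -- these matrices is enough, since it is invertible.
  have hspan : Submodule.span Ω (Set.range fun y : L × Fin N => p y.1 y.2) = ⊤ := by
    by_contra hne
    obtain ⟨f, hf0, hf⟩ := Submodule.exists_le_ker_of_lt_top _ (lt_top_iff_ne_top.2 hne)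
    refine hf0 ?_
    have h5 : ∀ x j, f (p x j) = 0 := fun x j =>
      hf (Submodule.subset_span ⟨(x, j), rfl⟩)
    have h6 : ∀ j, f (fun i => (a (l 1)) i j) = 0 := by
      intro j
      refine eq_zero_of_sum_galois_eq_zero (c := fun s => f fun i => (a (l s)) i j)
        (fun x => ?_) 1
      simpa [p, map_sum] using h5 x j
    have h7 : f ∘ₗ Matrix.toLin' (a (l 1)).1 = 0 := by
      refine LinearMap.pi_ext' fun j => LinearMap.ext_ring ?_
      simpa using! h6 j
    refine LinearMap.ext fun y => ?_
    have h8 := LinearMap.congr_fun h7 ((a (l 1))⁻¹.1 *ᵥ y)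
    rw [LinearMap.comp_apply, Matrix.toLin'_apply, Matrix.mulVec_mulVec, ← Units.val_mul,
      mul_inv_cancel, Units.val_one, Matrix.one_mulVec] at h8
    exact h8
  obtain ⟨f, hf, hli⟩ : ∃ f : Fin N → Fin N → Ω,
      (∀ i, f i ∈ Set.range fun y : L × Fin N => p y.1 y.2) ∧ LinearIndependent Ω f := by
    obtain ⟨f, hf, -, hli⟩ := Submodule.exists_fun_fin_finrank_span_eq Ω
      (Set.range fun y : L × Fin N => p y.1 y.2)
    have hN : Module.finrank Ω
        (Submodule.span Ω (Set.range fun y : L × Fin N => p y.1 y.2)) = N := by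
      rw [hspan, finrank_top, Module.finrank_fin_fun]
    exact ⟨f ∘ Fin.cast hN.symm, fun i => hf _, hli.comp _ (Fin.cast_injective _)⟩
  choose y hy using hf
  obtain ⟨P, hP⟩ : IsUnit (Matrix.of f)ᵀ := Matrix.linearIndependent_cols_iff_isUnit.1 hli
  have key : ∀ s, a s * galMap s P = P := by
    intro s
    ext i j
    have h5 := congrFun (hp s (y j).1 (y j).2) i
    have h6 : ∀ i, P i j = p (y j).1 (y j).2 i := fun i => by
      rw [hP]
      exact (congrFun (hy j) i).symm
    rw [← h6] at h5
    refine Eq.trans ?_ h5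
    simp only [← h6]
    rfl
  refine ⟨P⁻¹, fun s => ?_⟩
  rw [map_inv, inv_mul_eq_iff_eq_mul, eq_mul_inv_iff_mul_eq]
  exact key s

end

end GalCoh

/-! ### Twists: cocycles as coboundaries in `GL_N` -/

namespace GalCoh

noncomputable section

open Matrix

/-- An invertible matrix with entries in a subfield is invertible over the subfield. -/
theorem exists_map_eq_of_entries_mem_range {k K : Type*} [Field k] [Field K] (f : k →+* K) {N : ℕ}
    (g : GL (Fin N) K) (h : ∀ i j, g i j ∈ Set.range f) :
    ∃ g' : GL (Fin N) k, Matrix.GeneralLinearGroup.map f g' = g := by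
  choose m hm using h
  have hdet : IsUnit (Matrix.of m).det := by
    rw [isUnit_iff_ne_zero]
    intro h0
    have h1 : g.1 = f.mapMatrix (Matrix.of m) := by
      ext i j
      exact (hm i j).symm
    have h2 := (Matrix.isUnit_iff_isUnit_det _).1 g.isUnit
    rw [h1, ← RingHom.map_det, h0, map_zero] at h2
    exact not_isUnit_zero h2
  refine ⟨Matrix.GeneralLinearGroup.mk'' (Matrix.of m) hdet, ?_⟩
  ext i j
  exact hm i j

namespace LinearAlgebraicGroup

variable {F : Type w} [Field F] {N : ℕ} (A : LinearAlgebraicGroup F N)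

/-- The cocycle `a` is the coboundary of `g`: `a s = g⁻¹ * s g`. -/
def IsTwist (a : Cocycle Gal(SeparableClosure F/F) (A.ratPoints (SeparableClosure F)))
    (g : GL (Fin N) (SeparableClosure F)) : Prop :=
  ∀ s, g * (a.toFun s).1 = galMap s g

variable {A}

theorem exists_isTwist (a : Cocycle Gal(SeparableClosure F/F) (A.ratPoints (SeparableClosure F))) :
    ∃ g, A.IsTwist a g :=
  hilbert90 (fun s => (a.toFun s).1) (a.locallyConstant.comp Subtype.val) fun s t => by
    rw [a.map_mul]
    rfl

theorem isTwist_iff {a : Cocycle Gal(SeparableClosure F/F) (A.ratPoints (SeparableClosure F))}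
    {g : GL (Fin N) (SeparableClosure F)} :
    A.IsTwist a g ↔ ∀ s, (a.toFun s).1 = g⁻¹ * galMap s g :=
  forall_congr' fun _ => eq_inv_mul_iff_mul_eq.symm

theorem galMap_map (L : IntermediateField F (SeparableClosure F)) [Normal F L]
    (s : Gal(SeparableClosure F/F)) (g : GL (Fin N) L) :
    galMap s (Matrix.GeneralLinearGroup.map (algebraMap L (SeparableClosure F)) g) =
      Matrix.GeneralLinearGroup.map (algebraMap L (SeparableClosure F))
        (galMap (AlgEquiv.restrictNormalHom L s) g) := by
  refine Units.ext (Matrix.ext fun i j => ?_)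
  exact (AlgEquiv.restrictNormalHom_apply L s (g i j)).symm

theorem exists_finiteDimensional_map_eq (g : GL (Fin N) (SeparableClosure F)) :
    ∃ (L : IntermediateField F (SeparableClosure F)) (_ : FiniteDimensional F L)
      (_ : IsGalois F L) (g' : GL (Fin N) L),
      Matrix.GeneralLinearGroup.map (algebraMap L (SeparableClosure F)) g' = g := by
  let t : Set (SeparableClosure F) := Set.range fun p : Fin N × Fin N => g p.1 p.2
  let L := FiniteGaloisIntermediateField.adjoin F t
  obtain ⟨g', hg'⟩ := exists_map_eq_of_entries_mem_range
    (algebraMap L.toIntermediateField (SeparableClosure F)) g fun i j =>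
      ⟨⟨g i j, FiniteGaloisIntermediateField.subset_adjoin F t ⟨(i, j), rfl⟩⟩, rfl⟩
  exact ⟨L.toIntermediateField, L.finiteDimensional, L.isGalois, g', hg'⟩

theorem isLocallyConstant_galMap (g : GL (Fin N) (SeparableClosure F)) :
    IsLocallyConstant fun s : Gal(SeparableClosure F/F) => galMap s g := by
  obtain ⟨L, hL, hG, g, rfl⟩ := exists_finiteDimensional_map_eq g
  have h1 : IsLocallyConstant fun s : Gal(L/F) =>
      Matrix.GeneralLinearGroup.map (algebraMap L (SeparableClosure F)) (galMap s g) :=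
    IsLocallyConstant.of_discrete _
  convert! h1.comp_continuous (InfiniteGalois.restrictNormalHom_continuous L) using 1
  funext s
  exact galMap_map L s g

/-- The coboundary of `g`, as a cocycle with values in `A`. -/
def twistCocycle (g : GL (Fin N) (SeparableClosure F))
    (h : ∀ s : Gal(SeparableClosure F/F), g⁻¹ * galMap s g ∈ A.ratPoints (SeparableClosure F)) :
    Cocycle Gal(SeparableClosure F/F) (A.ratPoints (SeparableClosure F)) where
  toFun s := ⟨g⁻¹ * galMap s g, h s⟩
  locallyConstant := by
    have h1 : IsLocallyConstant fun s : Gal(SeparableClosure F/F) => g⁻¹ * galMap s g :=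
      (isLocallyConstant_galMap g).comp (g⁻¹ * ·)
    rw [IsLocallyConstant.iff_eventually_eq] at h1 ⊢
    exact fun s => (h1 s).mono fun t ht => Subtype.ext ht
  map_mul s t := by
    refine Subtype.ext ?_
    change g⁻¹ * galMap (s * t) g = g⁻¹ * galMap s g * galMap s (g⁻¹ * galMap t g)
    rw [map_mul, map_inv, mul_assoc, mul_inv_cancel_left]
    rfl

theorem isTwist_twistCocycle (g : GL (Fin N) (SeparableClosure F))
    (h : ∀ s : Gal(SeparableClosure F/F), g⁻¹ * galMap s g ∈ A.ratPoints (SeparableClosure F)) :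
    A.IsTwist (twistCocycle g h) g := isTwist_iff.2 fun _ => rfl

theorem IsTwist.mem {a : Cocycle Gal(SeparableClosure F/F) (A.ratPoints (SeparableClosure F))}
    {g : GL (Fin N) (SeparableClosure F)}
    (h : A.IsTwist a g) (s : Gal(SeparableClosure F/F)) :
    g⁻¹ * galMap s g ∈ A.ratPoints (SeparableClosure F) := by
  rw [← isTwist_iff.1 h s]
  exact (a.toFun s).2

/-- Cohomologous cocycles correspond to twists with the same class modulo `GL_N(F)` and `A`. -/
theorem cohomologous_iff {a a' : Cocycle Gal(SeparableClosure F/F) (A.ratPoints (SeparableClosure F))}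
    {g g' : GL (Fin N) (SeparableClosure F)}
    (h : A.IsTwist a g) (h' : A.IsTwist a' g') :
    Cohomologous _ _ a a' ↔ ∃ (c : GL (Fin N) F) (b : A.ratPoints (SeparableClosure F)),
      Matrix.GeneralLinearGroup.map (algebraMap F (SeparableClosure F)) c * g' = g * b.1 := by
  have aux : ∀ x x' b y y' v : GL (Fin N) (SeparableClosure F),
      x'⁻¹ * y' = b⁻¹ * (x⁻¹ * y) * v ↔ y * v * y'⁻¹ = x * b * x'⁻¹ := by
    intro x x' b y y' v
    constructor
    · intro e
      have : y' = x' * (b⁻¹ * (x⁻¹ * y) * v) := by rw [← e]; group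
      rw [this]
      group
    · intro e
      have : y' = x' * b⁻¹ * x⁻¹ * (y * v * y'⁻¹) * y' := by rw [e]; group
      rw [this]
      group
  -- The element b relates the two cocycles exactly when g b g'⁻¹ is fixed by Galois, that is, has
  -- entries in F.
  have hb : ∀ b : A.ratPoints (SeparableClosure F),
      (∀ s : Gal(SeparableClosure F/F), a'.toFun s = b⁻¹ * a.toFun s * s • b) ↔
      ∀ s : Gal(SeparableClosure F/F), galMap s (g * b.1 * g'⁻¹) = g * b.1 * g'⁻¹ := by
    intro b
    refine forall_congr' fun (s : Gal(SeparableClosure F/F)) => ?_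
    rw [Subtype.ext_iff, isTwist_iff.1 h' s]
    change _ = b.1⁻¹ * (a.toFun s).1 * galMap s b.1 ↔ _
    rw [isTwist_iff.1 h s, map_mul, map_mul, map_inv]
    exact aux _ _ _ _ _ _
  constructor
  · rintro ⟨b, h1⟩
    rw [hb] at h1
    obtain ⟨c, hc⟩ := exists_map_eq_of_entries_mem_range (algebraMap F (SeparableClosure F))
      (g * b.1 * g'⁻¹) (by
      intro i j
      rw [InfiniteGalois.mem_range_algebraMap_iff_fixed]
      intro s
      exact congrArg (fun x : GL (Fin N) (SeparableClosure F) => x i j) (h1 s))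
    exact ⟨c, b, by rw [hc, inv_mul_cancel_right]⟩
  · rintro ⟨c, b, hc⟩
    refine ⟨b, (hb b).2 fun s => ?_⟩
    rw [← hc, mul_inv_cancel_right]
    refine Units.ext (Matrix.ext fun i j => ?_)
    exact s.commutes _

end LinearAlgebraicGroup

end

end GalCoh

/-! ### Points of bounded degree on twisted cosets -/

namespace GalCoh

noncomputable section

open Matrix

/-! ### Equations of cosets, with exponents independent of the field -/

section CosetEquations

variable {N m r : ℕ}

/-- The coordinates of a matrix together with one more variable for the inverse of its
determinant. -/
abbrev PointIdx (N : ℕ) : Type := Option (Fin N × Fin N)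

/-- The coordinates of the parameters of a coset: a matrix and the parameters of the group. -/
abbrev ParamIdx (N m : ℕ) : Type := (Fin N × Fin N) ⊕ Fin m

/-- The equations for the points `x` with `f (y * x) = 0`, as polynomials in `x` with coefficients
polynomials in `y` and in the parameters of `f`, and the equation for the inverse of the
determinant of `x`. -/
def cosetEq (f : Fin r → MvPolynomial (ParamIdx N m) ℤ) :
    Option (Fin r) → MvPolynomial (PointIdx N) (MvPolynomial (ParamIdx N m) ℤ)
  | some j => MvPolynomial.eval₂ (Int.castRingHom _)
      (Sum.elim (fun p => ∑ l, MvPolynomial.C (MvPolynomial.X (.inl (p.1, l))) *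
        MvPolynomial.X (some (l, p.2))) fun t => MvPolynomial.C (MvPolynomial.X (.inr t))) (f j)
  | none => MvPolynomial.X none *
      (Matrix.of fun i j : Fin N => (MvPolynomial.X (some (i, j)) :
        MvPolynomial (PointIdx N) (MvPolynomial (ParamIdx N m) ℤ))).det - 1

/-- The value of the equations of the coset. -/
def cosetVal (f : Fin r → MvPolynomial (ParamIdx N m) ℤ) {E : Type*} [CommRing E]
    (y : ParamIdx N m → E) (x : PointIdx N → E) (j : Option (Fin r)) : E :=
  MvPolynomial.eval₂ (MvPolynomial.eval₂Hom (Int.castRingHom E) y) x (cosetEq f j)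

variable (f : Fin r → MvPolynomial (ParamIdx N m) ℤ) {E : Type*} [CommRing E]

theorem cosetVal_some (y : ParamIdx N m → E) (x : PointIdx N → E) (j : Fin r) :
    cosetVal f y x (some j) = MvPolynomial.aeval
      (Sum.elim (fun p => ∑ l, y (.inl (p.1, l)) * x (some (l, p.2))) fun t => y (.inr t)) (f j) := by
  rw [cosetVal, cosetEq, ← MvPolynomial.coe_eval₂Hom, MvPolynomial.hom_eval₂, MvPolynomial.aeval_def]
  congr 1
  · exact RingHom.ext_int _ _
  · funext i
    rcases i with i | i <;> simp

theorem cosetVal_none (y : ParamIdx N m → E) (x : PointIdx N → E) :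
    cosetVal f y x none = x none * (Matrix.of fun i j => x (some (i, j))).det - 1 := by
  rw [cosetVal, cosetEq, ← MvPolynomial.coe_eval₂Hom, map_sub, map_mul, RingHom.map_det, map_one,
    MvPolynomial.coe_eval₂Hom, MvPolynomial.eval₂_X]
  congr 3
  ext i j
  simp

/-- The equations of the coset with parameters `y`. -/
def cosetPoly (y : ParamIdx N m → E) (j : Option (Fin r)) : MvPolynomial (PointIdx N) E :=
  (cosetEq f j).map (MvPolynomial.eval₂Hom (Int.castRingHom E) y)

theorem eval₂_cosetPoly {E' : Type*} [CommRing E'] (φ : E →+* E') (y : ParamIdx N m → E)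
    (x : PointIdx N → E') (j : Option (Fin r)) :
    MvPolynomial.eval₂ φ x (cosetPoly f y j) = cosetVal f (fun i => φ (y i)) x j := by
  rw [cosetPoly, MvPolynomial.eval₂_map, cosetVal]
  congr 1
  ext <;> simp

/-- The exponents of the equations of the cosets. -/
def cosetSupport : Finset (PointIdx N →₀ ℕ) :=
  Finset.univ.biUnion fun j => (cosetEq f j).support

theorem support_cosetPoly (y : ParamIdx N m → E) (j : Option (Fin r)) :
    (cosetPoly f y j).support ⊆ cosetSupport f :=
  (MvPolynomial.support_map_subset _ _).trans
    (Finset.subset_biUnion_of_mem (fun j => (cosetEq f j).support) (Finset.mem_univ j))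

end CosetEquations

/-! ### Descent of equations by traces -/

section Trace

variable {F : Type w} [Field F] {L : Type*} [Field L] [Algebra F L] {σ : Type*}

/-- The trace of a multiple of a polynomial, coefficient by coefficient. -/
def tracePoly (M : Finset (σ →₀ ℕ)) (p : MvPolynomial σ L) (x : L) : MvPolynomial σ F :=
  ∑ e ∈ M, MvPolynomial.monomial e (Algebra.trace F L (x * p.coeff e))

theorem support_tracePoly (M : Finset (σ →₀ ℕ)) (p : MvPolynomial σ L) (x : L) :
    (tracePoly (F := F) M p x).support ⊆ M := by
  classical
  refine MvPolynomial.support_sum.trans (Finset.biUnion_subset.2 fun e he => ?_)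
  exact MvPolynomial.support_monomial_subset.trans (Finset.singleton_subset_iff.2 he)

/-- The trace is the sum over the conjugates. Combined with Dedekind independence, vanishing of
these values for all x amounts to vanishing of all conjugates of p at z. -/
theorem aeval_tracePoly [FiniteDimensional F L] [IsGalois F L] {Ω : Type*} [Field Ω] [Algebra F Ω]
    [Algebra L Ω] [IsScalarTower F L Ω] {M : Finset (σ →₀ ℕ)} {p : MvPolynomial σ L}
    (hp : p.support ⊆ M) (x : L) (z : σ → Ω) :
    MvPolynomial.aeval z (tracePoly (F := F) M p x) = ∑ s : Gal(L/F), algebraMap L Ω (s x) *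
      MvPolynomial.eval₂ ((algebraMap L Ω).comp (s : L →+* L)) z p := by
  have h1 : ∀ φ : L →+* Ω, MvPolynomial.eval₂ φ z p =
      ∑ e ∈ M, φ (p.coeff e) * e.prod fun i n => z i ^ n := by
    intro φ
    rw [MvPolynomial.eval₂_eq]
    refine Finset.sum_subset hp fun e _ he => ?_
    rw [MvPolynomial.notMem_support_iff.1 he, map_zero, zero_mul]
  simp only [h1, Finset.mul_sum]
  rw [Finset.sum_comm, tracePoly, map_sum]
  refine Finset.sum_congr rfl fun e _ => ?_
  rw [MvPolynomial.aeval_monomial, IsScalarTower.algebraMap_apply F L Ω,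
    trace_eq_sum_automorphisms, map_sum, Finset.sum_mul]
  refine Finset.sum_congr rfl fun s _ => ?_
  rw [map_mul, map_mul, mul_assoc]
  rfl

end Trace

end

end GalCoh

/-! ### Representatives over extensions of bounded degree -/

namespace GalCoh

noncomputable section

open Matrix

namespace LinearAlgebraicGroup

variable {F : Type w} [Field F] {N m r : ℕ}

/-- `A` is cut out of `GL_N` by the equations `f = 0` with parameters `c`. -/
def CutOut (A : LinearAlgebraicGroup F N) (f : Fin r → MvPolynomial (ParamIdx N m) ℤ)
    (c : Fin m → F) : Prop :=
  ∀ g : GL (Fin N) (AlgebraicClosure F), g ∈ A.points ↔ ∀ j, MvPolynomial.aeval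
    (Sum.elim (entries g) (fun i => algebraMap F (AlgebraicClosure F) (c i))) (f j) = 0

variable {A : LinearAlgebraicGroup F N} {f : Fin r → MvPolynomial (ParamIdx N m) ℤ} {c : Fin m → F}

theorem CutOut.mem_ratPoints_iff (hA : A.CutOut f c) {E : Type*} [Field E] [Algebra F E]
    [Algebra E (AlgebraicClosure F)] [IsScalarTower F E (AlgebraicClosure F)]
    (g : GL (Fin N) E) : g ∈ A.ratPoints E ↔ ∀ j, MvPolynomial.aeval
      (Sum.elim (entries g) (fun i => algebraMap F E (c i))) (f j) = 0 := by
  rw [ratPoints, Subgroup.mem_comap, hA]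
  refine forall_congr' fun j => ?_
  rw [← (algebraMap E (AlgebraicClosure F)).injective.eq_iff, map_zero,
    ← MvPolynomial.aeval_algebraMap_apply]
  refine iff_of_eq (congrArg (fun x => MvPolynomial.aeval x (f j) = 0) (funext fun i => ?_))
  rcases i with i | i
  · rfl
  · exact IsScalarTower.algebraMap_apply F E (AlgebraicClosure F) (c i)

/-- The value d fills the coordinate reserved for the inverse determinant, which does not occur in
these equations. -/
theorem CutOut.inv_mul_mem_iff (hA : A.CutOut f c) (g h : GL (Fin N) (SeparableClosure F))
    (d : SeparableClosure F) : g⁻¹ * h ∈ A.ratPoints (SeparableClosure F) ↔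
      ∀ j : Fin r, cosetVal f (Sum.elim (entries g⁻¹) fun i => algebraMap F _ (c i))
        (fun o => o.elim d (entries h)) (some j) = 0 := by
  rw [hA.mem_ratPoints_iff]
  refine forall_congr' fun j => ?_
  rw [cosetVal_some]
  refine iff_of_eq (congrArg (fun x => MvPolynomial.aeval x (f j) = 0) (funext fun i => ?_))
  rcases i with i | i <;> rfl

end LinearAlgebraicGroup

open LinearAlgebraicGroup

/-- Every cocycle in `A` is cohomologous to the coboundary of a matrix over a Galois extension
whose degree is bounded in terms of the equations of `A`. -/
theorem exists_bound_twist {N m r : ℕ} (f : Fin r → MvPolynomial (ParamIdx N m) ℤ) :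
    ∃ B : ℕ, ∀ (F : Type w) [Field F] (A : LinearAlgebraicGroup F N) (c : Fin m → F),
      A.CutOut f c →
      ∀ a : Cocycle Gal(SeparableClosure F/F) (A.ratPoints (SeparableClosure F)),
      ∃ (L : IntermediateField F (SeparableClosure F)) (_ : FiniteDimensional F L)
        (_ : IsGalois F L) (g : GL (Fin N) L)
        (a' : Cocycle Gal(SeparableClosure F/F) (A.ratPoints (SeparableClosure F))),
        Module.finrank F L ≤ B ∧ Cohomologous _ _ a a' ∧
          A.IsTwist a' (Matrix.GeneralLinearGroup.map (algebraMap L (SeparableClosure F)) g) := by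
  obtain ⟨B, hB⟩ := exists_bound_finrank.{w} (cosetSupport f)
  refine ⟨B, fun F _ A c hA a => ?_⟩
  obtain ⟨g₀, hg₀⟩ := exists_isTwist a
  obtain ⟨E, hE, hEG, g₁, rfl⟩ := exists_finiteDimensional_map_eq g₀
  let ι : E →+* SeparableClosure F := algebraMap E (SeparableClosure F)
  let y : ParamIdx N m → E := Sum.elim (entries g₁⁻¹) fun i => algebraMap F E (c i)
  have hy : ∀ (s : Gal(SeparableClosure F/F)), (fun i => ι (AlgEquiv.restrictNormalHom E s (y i))) =
      Sum.elim (entries (galMap s (Matrix.GeneralLinearGroup.map ι g₁))⁻¹)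
        fun i => algebraMap F _ (c i) := by
    intro s
    rw [galMap_map, ← map_inv, ← map_inv]
    funext i
    rcases i with i | i
    · rfl
    · exact congrArg ι ((AlgEquiv.restrictNormalHom E s).commutes (c i))
  -- Equations over F for the coset of g₀: traces of all E-multiples of its equations over E, with
  -- the same exponents.
  let W : Set (MvPolynomial (PointIdx N) F) :=
    Set.range fun p : Option (Fin r) × E => tracePoly (cosetSupport f) (cosetPoly f y p.1) p.2
  obtain ⟨L, hL, hLG, z, hfin, hz⟩ := hB F W
    (by rintro _ ⟨p, rfl⟩; exact support_tracePoly _ _ _)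
    (by
      -- The matrix g₀ itself solves the system: s(g₀)⁻¹ g₀ is the inverse of a cocycle value, hence
      -- in A, so g₀ satisfies all conjugate equations.
      refine ⟨fun o => o.elim (ι g₁⁻¹.1.det) (entries (Matrix.GeneralLinearGroup.map ι g₁)), ?_⟩
      rintro _ ⟨⟨j, x⟩, rfl⟩
      rw [aeval_tracePoly (support_cosetPoly f y j)]
      refine Finset.sum_eq_zero fun s _ => ?_
      obtain ⟨s, rfl⟩ := AlgEquiv.restrictNormalHom_surjective (F := F) (K₁ := E)
        (SeparableClosure F) s
      convert! mul_zero _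
      rw [eval₂_cosetPoly]
      change cosetVal f (fun i => ι (AlgEquiv.restrictNormalHom E s (y i))) _ j = 0
      rw [hy]
      rcases j with _ | j
      · rw [cosetVal_none, sub_eq_zero]
        change ι g₁⁻¹.1.det * (ι.mapMatrix g₁.1).det = 1
        rw [← RingHom.map_det, ← map_mul, ← Matrix.det_mul, ← Units.val_mul, inv_mul_cancel,
          Units.val_one, Matrix.det_one, map_one]
      · refine (hA.inv_mul_mem_iff _ _ _).1 ?_ j
        have := (A.ratPoints (SeparableClosure F)).inv_mem (hg₀.mem s)
        rwa [_root_.mul_inv_rev, inv_inv] at this)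
  -- Dedekind independence recovers each conjugate equation from the traces; the one for the
  -- identity says that z lies on g₀A.
  have hz1 : ∀ j, cosetVal f (fun i => ι (y i)) (fun i => algebraMap L (SeparableClosure F) (z i))
      j = 0 := by
    intro j
    have h1 := eq_zero_of_sum_galois_eq_zero (F := F) (L := E) (c := fun s : Gal(E/F) =>
      MvPolynomial.eval₂ (ι.comp (s : E →+* E))
        (fun i => algebraMap L (SeparableClosure F) (z i)) (cosetPoly f y j)) (fun x => by
      rw [← aeval_tracePoly (support_cosetPoly f y j)]
      refine (MvPolynomial.aeval_algebraMap_apply _ z _).trans ?_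
      rw [hz _ ⟨(j, x), rfl⟩, map_zero]) 1
    rwa [eval₂_cosetPoly] at h1
  have hdet : IsUnit (Matrix.of fun i j => z (some (i, j))).det := by
    have h1 := hz1 none
    rw [cosetVal_none, sub_eq_zero] at h1
    refine isUnit_iff_ne_zero.2 fun h0 => ?_
    have h2 := RingHom.map_det (algebraMap L (SeparableClosure F))
      (Matrix.of fun i j => z (some (i, j)))
    rw [h0, map_zero] at h2
    refine zero_ne_one (α := SeparableClosure F) (Eq.trans ?_ h1)
    exact (mul_eq_zero_of_right _ h2.symm).symm
  let g : GL (Fin N) L := Matrix.GeneralLinearGroup.mk'' _ hdet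
  have hb : (Matrix.GeneralLinearGroup.map ι g₁)⁻¹ *
      Matrix.GeneralLinearGroup.map (algebraMap L (SeparableClosure F)) g ∈
        A.ratPoints (SeparableClosure F) := by
    rw [hA.inv_mul_mem_iff _ _ (algebraMap L (SeparableClosure F) (z none))]
    intro j
    convert! hz1 (some j) using 2
    · funext i
      rcases i with i | i
      · rw [← map_inv]
        rfl
      · rfl
    · funext o
      rcases o with _ | o <;> rfl
  -- With b = g₀⁻¹ g in A, one has g⁻¹ s(g) = b⁻¹ (g₀⁻¹ s(g₀)) s(b).
  have hg : ∀ s : Gal(SeparableClosure F/F),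
      (Matrix.GeneralLinearGroup.map (algebraMap L (SeparableClosure F)) g)⁻¹ *
        galMap s (Matrix.GeneralLinearGroup.map (algebraMap L (SeparableClosure F)) g) ∈
          A.ratPoints (SeparableClosure F) := by
    intro s
    have h1 := mul_mem (mul_mem (inv_mem hb) (hg₀.mem s))
      (A.map_mem_ratPoints (SeparableClosure F) s hb)
    convert! h1 using 1
    change _ = _ * _ * galMap s _
    rw [map_mul, map_inv, show algebraMap E (SeparableClosure F) = ι from rfl]
    group
  refine ⟨L, hL, hLG, g, twistCocycle _ hg, hfin, ?_, isTwist_twistCocycle _ hg⟩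
  rw [cohomologous_iff hg₀ (isTwist_twistCocycle _ hg)]
  exact ⟨1, ⟨_, hb⟩, by rw [map_one, one_mul, mul_inv_cancel_left]⟩

end

end GalCoh

/-! ### Codes of finite Galois extensions -/

namespace GalCoh

noncomputable section

open Polynomial

variable {F : Type w} [Field F] {d : ℕ}

/-- The polynomial with coefficients `v`. -/
def tuplePoly (v : Fin d → F) : F[X] := ∑ k, C (v k) * X ^ (k : ℕ)

theorem aeval_tuplePoly {E : Type*} [Field E] [Algebra F E] (v : Fin d → F) (x : E) :
    aeval x (tuplePoly v) = ∑ k, algebraMap F E (v k) * x ^ (k : ℕ) := by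
  simp [tuplePoly]

theorem degree_tuplePoly_lt (v : Fin d → F) : (tuplePoly v).degree < d :=
  degree_sum_fin_lt v

theorem coeff_tuplePoly (v : Fin d → F) (k : Fin d) : (tuplePoly v).coeff k = v k := by
  simp [tuplePoly, coeff_C_mul, coeff_X_pow, Fin.val_inj]

theorem tuplePoly_coeff {p : F[X]} (hp : p.degree < d) : tuplePoly (fun k : Fin d => p.coeff k) = p := by
  ext n
  by_cases hn : n < d
  · exact coeff_tuplePoly _ ⟨n, hn⟩
  · rw [coeff_eq_zero_of_degree_lt ((degree_tuplePoly_lt _).trans_le (by exact_mod_cast not_lt.1 hn)),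
      coeff_eq_zero_of_degree_lt (hp.trans_le (by exact_mod_cast not_lt.1 hn))]

/-- The tuple `(β, α)` codes a Galois extension of degree `d`: `β` is a generator and `α` lists its
conjugates. -/
def IsGalCode (β : AlgebraicClosure F) (α : Fin d → AlgebraicClosure F) : Prop :=
  (∀ i j, α i = α j → i = j) ∧ (∃ i, β = α i) ∧
    (∀ i, ∃ r : Fin d → F, α i = ∑ k, algebraMap F _ (r k) * β ^ (k : ℕ)) ∧
    (∃ c : Fin d → F, ∀ i, α i ^ d + ∑ k, algebraMap F _ (c k) * α i ^ (k : ℕ) = 0) ∧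
    ∀ r : Fin d → F, ∑ k, algebraMap F _ (r k) * β ^ (k : ℕ) = 0 → ∀ k, r k = 0

/-- A power basis from a primitive element. -/
def powerBasisOfAdjoin {L : Type*} [Field L] [Algebra F L] [FiniteDimensional F L] {b : L}
    (hb : IntermediateField.adjoin F {b} = ⊤) : PowerBasis F L :=
  (IntermediateField.adjoin.powerBasis (Algebra.IsIntegral.isIntegral b)).map
    ((IntermediateField.equivOfEq hb).trans IntermediateField.topEquiv)

theorem powerBasisOfAdjoin_gen {L : Type*} [Field L] [Algebra F L] [FiniteDimensional F L] {b : L}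
    (hb : IntermediateField.adjoin F {b} = ⊤) : (powerBasisOfAdjoin hb).gen = b := rfl

theorem finrank_eq_natDegree_of_adjoin {L : Type*} [Field L] [Algebra F L] [FiniteDimensional F L]
    {b : L} (hb : IntermediateField.adjoin F {b} = ⊤) :
    Module.finrank F L = (minpoly F b).natDegree := by
  rw [(powerBasisOfAdjoin hb).finrank, ← (powerBasisOfAdjoin hb).natDegree_minpoly,
    powerBasisOfAdjoin_gen]

theorem exists_eq_sum_pow {L : Type*} [Field L] [Algebra F L] [FiniteDimensional F L] {b : L}
    (hb : IntermediateField.adjoin F {b} = ⊤) (hd : Module.finrank F L = d) (x : L) :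
    ∃ r : Fin d → F, x = ∑ k, algebraMap F L (r k) * b ^ (k : ℕ) := by
  obtain ⟨p, hp, hx⟩ := (powerBasisOfAdjoin hb).exists_eq_aeval x
  rw [← (powerBasisOfAdjoin hb).finrank, hd] at hp
  refine ⟨fun k => p.coeff k, ?_⟩
  rw [← aeval_tuplePoly, tuplePoly_coeff ((degree_le_natDegree).trans_lt (by exact_mod_cast hp))]
  exact hx

theorem aeval_eq_zero_of_degree_lt {L : Type*} [Field L] [Algebra F L] {x : L}
    {p : F[X]} (h : aeval x p = 0) (hp : p.degree < (minpoly F x).degree) : p = 0 := by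
  by_contra h0
  exact (minpoly.degree_le_of_ne_zero F x h0 h).not_gt hp

section

variable {L : IntermediateField F (SeparableClosure F)} [FiniteDimensional F L]

theorem isGalCode_of_equiv {b : L} (hb : IntermediateField.adjoin F {b} = ⊤)
    (e : Fin d ≃ Gal(L/F)) (hd : Module.finrank F L = d) :
    IsGalCode (algebraMap L (AlgebraicClosure F) b)
      fun i => algebraMap L (AlgebraicClosure F) (e i b) := by
  have hdeg : (minpoly F b).natDegree = d := by rw [← finrank_eq_natDegree_of_adjoin hb, hd]
  have hdeg' : (minpoly F b).degree = d := by
    rw [degree_eq_natDegree (minpoly.ne_zero (Algebra.IsIntegral.isIntegral b)), hdeg]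
  have hmap : ∀ (r : Fin d → F) (x : L),
      ∑ k, algebraMap F (AlgebraicClosure F) (r k) * algebraMap L (AlgebraicClosure F) x ^ (k : ℕ) =
        algebraMap L (AlgebraicClosure F) (∑ k, algebraMap F L (r k) * x ^ (k : ℕ)) := by
    intro r x
    simp only [map_sum, map_mul, map_pow, ← IsScalarTower.algebraMap_apply]
  refine ⟨fun i j hij => ?_, ⟨e.symm 1, by simp⟩, fun i => ?_, ?_, fun r hr => ?_⟩
  · refine e.injective ?_
    have h1 : e i b = e j b := (algebraMap L (AlgebraicClosure F)).injective hij
    have h2 := (powerBasisOfAdjoin hb).algHom_ext (f := (e i : L →ₐ[F] L))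
      (g := (e j : L →ₐ[F] L)) h1
    ext1 x
    exact DFunLike.congr_fun h2 x
  · obtain ⟨r, hr⟩ := exists_eq_sum_pow hb hd (e i b)
    exact ⟨r, by rw [hmap, ← hr]⟩
  -- The coefficients of the minimal polynomial without its leading term.
  · refine ⟨fun k => (minpoly F b - X ^ d).coeff k, fun i => ?_⟩
    have h1 : aeval (e i b) (minpoly F b) = 0 := by
      rw [← AlgEquiv.coe_toAlgHom (e i), aeval_algHom_apply, minpoly.aeval, map_zero]
    have h2 : (minpoly F b - X ^ d).degree < (d : WithBot ℕ) := by
      conv_rhs => rw [← hdeg']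
      refine degree_sub_lt_left ?_ (minpoly.ne_zero (Algebra.IsIntegral.isIntegral b)) ?_
      · rw [degree_X_pow, hdeg']
      · rw [minpoly.monic (Algebra.IsIntegral.isIntegral b), (monic_X_pow d).leadingCoeff]
    rw [hmap, ← aeval_tuplePoly, tuplePoly_coeff h2, ← map_pow, ← map_add, map_sub, h1, map_pow, aeval_X]
    simp
  · rw [hmap, map_eq_zero, ← aeval_tuplePoly] at hr
    have h1 := aeval_eq_zero_of_degree_lt hr (by rw [hdeg']; exact degree_tuplePoly_lt r)
    intro k
    rw [← coeff_tuplePoly r k, h1, coeff_zero]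

end

/-- Independence of the powers of β makes the given monic polynomial of degree d its minimal
polynomial. The d distinct roots α i make it separable, so β lies in F^sep. Each α i lies in F(β)
and so defines an automorphism; d automorphisms in degree d force the extension to be Galois. -/
theorem IsGalCode.exists_equiv {β : AlgebraicClosure F} {α : Fin d → AlgebraicClosure F}
    (h : IsGalCode β α) :
    ∃ (L : IntermediateField F (SeparableClosure F)) (_ : FiniteDimensional F L)
      (_ : IsGalois F L) (b : L) (e : Fin d ≃ Gal(L/F)),
      IntermediateField.adjoin F {b} = ⊤ ∧ β = algebraMap L (AlgebraicClosure F) b ∧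
        ∀ i, α i = algebraMap L (AlgebraicClosure F) (e i b) := by
  obtain ⟨hinj, ⟨i₀, hi₀⟩, hr, ⟨c, hc⟩, hli⟩ := h
  let p : F[X] := X ^ d + tuplePoly c
  have hp : p.Monic := monic_X_pow_add (degree_tuplePoly_lt c)
  have hpd : p.natDegree = d := by
    refine natDegree_eq_of_degree_eq_some ?_
    rw [degree_add_eq_left_of_degree_lt, degree_X_pow]
    rw [degree_X_pow]
    exact degree_tuplePoly_lt c
  have hα : ∀ i, aeval (α i) p = 0 := fun i => by
    rw [map_add, map_pow, aeval_X, aeval_tuplePoly, hc]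
  have hint : IsIntegral F β := Algebra.IsIntegral.isIntegral β
  have hmin : p = minpoly F β := by
    refine eq_of_monic_of_dvd_of_natDegree_le (minpoly.monic hint) hp
      (minpoly.dvd F β (hi₀ ▸ hα i₀)) ?_
    rw [hpd]
    by_contra! hlt
    have h1 : (minpoly F β).degree < d := degree_le_natDegree.trans_lt (by exact_mod_cast hlt)
    have h2 := hli (fun k => (minpoly F β).coeff k) (by
      rw [← aeval_tuplePoly, tuplePoly_coeff h1, minpoly.aeval])
    refine minpoly.ne_zero hint ?_
    rw [← tuplePoly_coeff h1]
    simp [tuplePoly, h2]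
  have hsep : p.Separable := by
    rw [← card_rootSet_eq_natDegree_iff_of_splits (K := AlgebraicClosure F) hp.ne_zero
      (IsAlgClosed.splits _)]
    refine le_antisymm ?_ ?_
    · have := ncard_rootSet_le p (AlgebraicClosure F)
      rwa [← Nat.card_coe_set_eq, Nat.card_eq_fintype_card] at this
    · rw [hpd]
      conv_lhs => rw [← Fintype.card_fin d]
      exact Fintype.card_le_of_injective
        (fun i => (⟨α i, mem_rootSet.2 ⟨hp.ne_zero, hα i⟩⟩ : p.rootSet (AlgebraicClosure F)))
        fun i j hij => hinj i j (congrArg Subtype.val hij)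
  let b₀ : SeparableClosure F := ⟨β, mem_separableClosure_iff.2 (by
    rw [IsSeparable, ← hmin]; exact hsep)⟩
  let L : IntermediateField F (SeparableClosure F) := IntermediateField.adjoin F {b₀}
  let b : L := IntermediateField.AdjoinSimple.gen F b₀
  have hβ : β = algebraMap L (AlgebraicClosure F) b := rfl
  have hb₀ : IsIntegral F b₀ := Algebra.IsIntegral.isIntegral b₀
  have : FiniteDimensional F L := IntermediateField.adjoin.finiteDimensional hb₀
  have hminb : minpoly F b = p := by
    rw [hmin, hβ, minpoly.algebraMap_eq (algebraMap L (AlgebraicClosure F)).injective]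
  have hfin : Module.finrank F L = d := by
    rw [IntermediateField.adjoin.finrank hb₀, ← hpd, ← hminb]
    exact congrArg natDegree (IntermediateField.minpoly_gen F b₀).symm
  have hb : IntermediateField.adjoin F {b} = ⊤ := by
    rw [Field.primitive_element_iff_minpoly_natDegree_eq, hminb, hpd, hfin]
  have hσ : ∀ i, ∃ σ : Gal(L/F), α i = algebraMap L (AlgebraicClosure F) (σ b) := by
    intro i
    obtain ⟨r, hri⟩ := hr i
    let a : L := ∑ k, algebraMap F L (r k) * b ^ (k : ℕ)
    have ha : α i = algebraMap L (AlgebraicClosure F) a := by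
      rw [hri, hβ]
      simp only [a, map_sum, map_mul, map_pow, ← IsScalarTower.algebraMap_apply]
    have ha0 : aeval a (minpoly F (powerBasisOfAdjoin hb).gen) = 0 := by
      rw [powerBasisOfAdjoin_gen, hminb]
      apply (algebraMap L (AlgebraicClosure F)).injective
      rw [← aeval_algebraMap_apply, ← ha, hα, map_zero]
    refine ⟨AlgEquiv.ofBijective ((powerBasisOfAdjoin hb).lift a ha0)
      (Algebra.IsAlgebraic.algHom_bijective _), ?_⟩
    rw [ha]
    exact congrArg _ ((powerBasisOfAdjoin hb).lift_gen a ha0).symm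
  choose σ hσ using hσ
  have hσi : Function.Injective σ := fun i j hij => hinj i j (by rw [hσ, hσ, hij])
  have hcard : Fintype.card Gal(L/F) = d := by
    refine le_antisymm (AlgEquiv.card_le.trans hfin.le) ?_
    simpa using Fintype.card_le_of_injective σ hσi
  refine ⟨L, inferInstance, IsGalois.of_card_aut_eq_finrank F L ?_, b,
    Equiv.ofBijective σ ((Fintype.bijective_iff_injective_and_card σ).2
      ⟨hσi, by rw [hcard, Fintype.card_fin]⟩), hb, hβ, fun i => hσ i⟩
  rw [Nat.card_eq_fintype_card, hcard, hfin]

end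

end GalCoh

/-! ### Codes of twists -/

namespace GalCoh

noncomputable section

open Matrix

/-- The product of matrices given by their tuples of entries. -/
def tupleMul {N : ℕ} {E : Type*} [Field E] (x y : Fin N × Fin N → E) : Fin N × Fin N → E :=
  fun p => ∑ t, x (p.1, t) * y (t, p.2)

/-- The tuple of entries of the unit matrix. -/
def tupleOne {N : ℕ} {E : Type*} [Field E] : Fin N × Fin N → E :=
  fun p => if p.1 = p.2 then 1 else 0

section Entries

variable {N : ℕ} {E E' : Type*} [Field E] [Field E']

theorem entries_mul (g h : GL (Fin N) E) : entries (g * h) = tupleMul (entries g) (entries h) :=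
  rfl

theorem entries_injective : Function.Injective (entries : GL (Fin N) E → _) := fun _ _ h =>
  Units.ext (Matrix.ext fun i j => congrFun h (i, j))

theorem entries_map (f : E →+* E') (g : GL (Fin N) E) :
    entries (Matrix.GeneralLinearGroup.map f g) = fun p => f (entries g p) := rfl

/-- A one-sided inverse suffices for square matrices, which makes invertibility an existential
condition on entries. -/
theorem exists_entries_eq_iff (x : Fin N × Fin N → E) :
    (∃ g : GL (Fin N) E, entries g = x) ↔ ∃ y, tupleMul x y = tupleOne := by
  constructor
  · rintro ⟨g, rfl⟩
    refine ⟨entries g⁻¹, ?_⟩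
    rw [← entries_mul, mul_inv_cancel]
    rfl
  · rintro ⟨y, hy⟩
    have h1 : (Matrix.of fun i j => x (i, j)) * (Matrix.of fun i j => y (i, j)) = 1 := by
      ext i j
      exact (congrFun hy (i, j)).trans (Matrix.one_apply (i := i) (j := j)).symm
    exact ⟨⟨_, _, h1, mul_eq_one_comm.1 h1⟩, rfl⟩

theorem map_injective (f : E →+* E') :
    Function.Injective (Matrix.GeneralLinearGroup.map (n := Fin N) f) := fun _ _ e =>
  entries_injective (funext fun p => f.injective (congrFun (congrArg entries e) p))

end Entries

/-- The relations expressing that `(β, α, m)` codes the coboundary of the matrix `h`, with values in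
the set of matrices `S`. -/
def IsTwistCode {F : Type w} [Field F] {N d : ℕ} (S : (Fin N × Fin N → AlgebraicClosure F) → Prop)
    (h : Fin N × Fin N → AlgebraicClosure F) (β : AlgebraicClosure F)
    (α : Fin d → AlgebraicClosure F) (m : Fin d → Fin N → Fin N → AlgebraicClosure F) : Prop :=
  IsGalCode β α ∧ (∃ y, tupleMul h y = tupleOne) ∧ (∀ i, S fun p => m i p.1 p.2) ∧
    ∀ p, ∃ r : Fin d → F, h p = ∑ k, algebraMap F _ (r k) * β ^ (k : ℕ) ∧
      ∀ i, ∑ k, algebraMap F _ (r k) * α i ^ (k : ℕ) = tupleMul h (fun q => m i q.1 q.2) p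

namespace LinearAlgebraicGroup

variable {F : Type w} [Field F] {N : ℕ} (A : LinearAlgebraicGroup F N)

/-- The tuple `x` lists the entries of a point of `A`. -/
def IsPoint (x : Fin N × Fin N → AlgebraicClosure F) : Prop := ∃ g ∈ A.points, entries g = x

variable {A}

theorem IsTwist.eq {a a' : Cocycle Gal(SeparableClosure F/F) (A.ratPoints (SeparableClosure F))}
    {g : GL (Fin N) (SeparableClosure F)} (h : A.IsTwist a g) (h' : A.IsTwist a' g) : a = a' := by
  have : a.toFun = a'.toFun := funext fun s =>
    Subtype.ext ((isTwist_iff.1 h s).trans (isTwist_iff.1 h' s).symm)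
  cases a
  cases a'
  congr

/-! ### Twists and codes over a finite Galois extension -/

section Finite

variable {L : IntermediateField F (SeparableClosure F)}

theorem isTwist_inflCocycle [Normal F L] {a : Cocycle Gal(L/F) (A.ratPoints L)} {g : GL (Fin N) L}
    (h : ∀ s, g * (a.toFun s).1 = galMap s g) :
    A.IsTwist (A.inflCocycle L a)
      (Matrix.GeneralLinearGroup.map (algebraMap L (SeparableClosure F)) g) := fun s => by
  rw [galMap_map, ← h, map_mul]
  rfl

/-- The coboundary of a matrix over a finite extension. -/
def finiteTwist [FiniteDimensional F L] (g : GL (Fin N) L)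
    (h : ∀ s : Gal(L/F), g⁻¹ * galMap s g ∈ A.ratPoints L) : Cocycle Gal(L/F) (A.ratPoints L) where
  toFun s := ⟨g⁻¹ * galMap s g, h s⟩
  locallyConstant := IsLocallyConstant.of_discrete _
  map_mul s t := by
    refine Subtype.ext ?_
    change g⁻¹ * galMap (s * t) g = g⁻¹ * galMap s g * galMap s (g⁻¹ * galMap t g)
    rw [map_mul, map_inv, mul_assoc, mul_inv_cancel_left]
    rfl

theorem mul_finiteTwist [FiniteDimensional F L] (g : GL (Fin N) L)
    (h : ∀ s : Gal(L/F), g⁻¹ * galMap s g ∈ A.ratPoints L) (s : Gal(L/F)) :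
    g * ((finiteTwist g h).toFun s).1 = galMap s g := mul_inv_cancel_left g _

theorem IsTwist.exists_inflCocycle_eq [FiniteDimensional F L] [Normal F L]
    {a : Cocycle Gal(SeparableClosure F/F) (A.ratPoints (SeparableClosure F))}
    {g : GL (Fin N) L}
    (h : A.IsTwist a (Matrix.GeneralLinearGroup.map (algebraMap L (SeparableClosure F)) g)) :
    ∃ a' : Cocycle Gal(L/F) (A.ratPoints L),
      (∀ s, g * (a'.toFun s).1 = galMap s g) ∧ A.inflCocycle L a' = a := by
  have h1 : ∀ s : Gal(L/F), g⁻¹ * galMap s g ∈ A.ratPoints L := by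
    intro s
    obtain ⟨t, rfl⟩ := AlgEquiv.restrictNormalHom_surjective (F := F) (K₁ := L)
      (SeparableClosure F) s
    have h2 := h.mem t
    rw [galMap_map, ← map_inv, ← map_mul] at h2
    exact h2
  exact ⟨finiteTwist g h1, mul_finiteTwist g h1,
    (isTwist_inflCocycle (mul_finiteTwist g h1)).eq h⟩

theorem exists_codes [FiniteDimensional F L] [IsGalois F L] (a : Cocycle Gal(L/F) (A.ratPoints L)) :
    ∃ (β : AlgebraicClosure F) (α : Fin (Module.finrank F L) → AlgebraicClosure F)
      (m : Fin (Module.finrank F L) → Fin N → Fin N → AlgebraicClosure F), A.Codes a β α m := by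
  obtain ⟨b, hb⟩ := Field.exists_primitive_element F L
  have hcard : Fintype.card Gal(L/F) = Module.finrank F L := by
    rw [← Nat.card_eq_fintype_card, IsGalois.card_aut_eq_finrank]
  exact ⟨_, _, _, b, (Fintype.equivFinOfCardEq hcard).symm, hb, rfl, fun i => ⟨rfl, fun _ _ => rfl⟩⟩

end Finite

/-- The automorphism s_i sends a polynomial in β over F to the same polynomial in α i. So the last
clause of `IsTwistCode` says that h has entries in F(β) and that s_i(h) = h m_i; the cocycle is then
recovered as h⁻¹ s(h). -/
theorem isTwistCode_iff {d : ℕ} {h : Fin N × Fin N → AlgebraicClosure F} {β : AlgebraicClosure F}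
    {α : Fin d → AlgebraicClosure F} {m : Fin d → Fin N → Fin N → AlgebraicClosure F} :
    IsTwistCode A.IsPoint h β α m ↔ ∃ (L : IntermediateField F (SeparableClosure F))
      (_ : FiniteDimensional F L) (_ : IsGalois F L) (g : GL (Fin N) L)
      (a : Cocycle Gal(L/F) (A.ratPoints L)), (∀ s, g * (a.toFun s).1 = galMap s g) ∧
        A.Codes a β α m ∧
        h = entries (Matrix.GeneralLinearGroup.map (algebraMap L (AlgebraicClosure F)) g) := by
  constructor
  · rintro ⟨hg, hinv, hm, hr⟩
    obtain ⟨L, fd, gal, b, e, hb, rfl, hα⟩ := hg.exists_equiv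
    obtain rfl : α = _ := funext hα
    refine ⟨L, fd, gal, ?_⟩
    choose r hr hs using hr
    let x : Fin N × Fin N → L := fun p => ∑ k, algebraMap F L (r p k) * b ^ (k : ℕ)
    have hx : ∀ p, h p = algebraMap L (AlgebraicClosure F) (x p) := fun p => by
      rw [hr]
      simp only [x, map_sum, map_mul, map_pow, ← IsScalarTower.algebraMap_apply]
    have hxs : ∀ i p, algebraMap L (AlgebraicClosure F) (e i (x p)) =
        tupleMul h (fun q => m i q.1 q.2) p := fun i p => by
      rw [← hs]
      simp only [x, map_sum, map_mul, map_pow, ← IsScalarTower.algebraMap_apply,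
        AlgEquiv.commutes]
    obtain ⟨G, rfl⟩ := (exists_entries_eq_iff h).2 hinv
    obtain ⟨g, rfl⟩ := exists_map_eq_of_entries_mem_range (algebraMap L (AlgebraicClosure F)) G
      fun i j => ⟨x (i, j), (hx (i, j)).symm⟩
    have hgx : ∀ p, entries g p = x p := fun p =>
      (algebraMap L (AlgebraicClosure F)).injective (hx p)
    choose M hM hMm using hm
    have hmul : ∀ i, Matrix.GeneralLinearGroup.map (algebraMap L (AlgebraicClosure F))
        (g⁻¹ * galMap (e i) g) = M i := by
      intro i
      rw [map_mul, map_inv, inv_mul_eq_iff_eq_mul]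
      refine entries_injective ?_
      rw [entries_mul, hMm]
      funext p
      rw [← hxs, ← hgx]
      rfl
    have hmem : ∀ s : Gal(L/F), g⁻¹ * galMap s g ∈ A.ratPoints L := by
      intro s
      obtain ⟨i, rfl⟩ := e.surjective s
      rw [ratPoints, Subgroup.mem_comap, hmul]
      exact hM i
    refine ⟨g, finiteTwist g hmem, mul_finiteTwist g hmem,
      ⟨b, e, hb, rfl, fun i => ⟨rfl, fun j k => ?_⟩⟩, rfl⟩
    refine Eq.trans ?_ (congrFun (congrArg entries (hmul i)) (j, k)).symm
    exact (congrFun (hMm i) (j, k)).symm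
  · rintro ⟨L, fd, gal, g, a, hga, ⟨b, e, hb, rfl, hα⟩, rfl⟩
    obtain rfl : α = _ := funext fun i => (hα i).1
    have hm : ∀ i, (fun p : Fin N × Fin N => m i p.1 p.2) = entries
        (Matrix.GeneralLinearGroup.map (algebraMap L (AlgebraicClosure F)) (a.toFun (e i)).1) :=
      fun i => funext fun p => (hα i).2 p.1 p.2
    have hd : Module.finrank F L = d := by
      rw [← IsGalois.card_aut_eq_finrank, ← Nat.card_congr e, Nat.card_fin]
    refine ⟨isGalCode_of_equiv hb e hd, (exists_entries_eq_iff _).1 ⟨_, rfl⟩,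
      fun i => ⟨_, (a.toFun (e i)).2, (hm i).symm⟩, fun p => ?_⟩
    obtain ⟨r, hr⟩ := exists_eq_sum_pow hb hd (entries g p)
    have hmap : ∀ x : L, ∑ k, algebraMap F (AlgebraicClosure F) (r k) *
        algebraMap L (AlgebraicClosure F) x ^ (k : ℕ) =
        algebraMap L (AlgebraicClosure F) (∑ k, algebraMap F L (r k) * x ^ (k : ℕ)) := by
      intro x
      simp only [map_sum, map_mul, map_pow, ← IsScalarTower.algebraMap_apply]
    refine ⟨r, ?_, fun i => ?_⟩
    · rw [hmap, ← hr]
      rfl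
    · rw [hmap, hm, ← entries_mul, ← map_mul, hga, entries_map]
      change _ = algebraMap L (AlgebraicClosure F) (e i (entries g p))
      rw [hr]
      simp only [map_sum, map_mul, map_pow, AlgEquiv.commutes]

/-- A tuple with a code lists the entries of a matrix whose coboundary is a cocycle in `A`. -/
theorem exists_isTwist_of_isTwistCode {d : ℕ} {h : Fin N × Fin N → AlgebraicClosure F}
    {β : AlgebraicClosure F} {α : Fin d → AlgebraicClosure F}
    {m : Fin d → Fin N → Fin N → AlgebraicClosure F} (hh : IsTwistCode A.IsPoint h β α m) :
    ∃ g a, A.IsTwist a g ∧ h = entries (Matrix.GeneralLinearGroup.map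
      (algebraMap (SeparableClosure F) (AlgebraicClosure F)) g) := by
  obtain ⟨L, fd, gal, g, a, hga, -, rfl⟩ := isTwistCode_iff.1 hh
  exact ⟨_, _, isTwist_inflCocycle hga, rfl⟩

section Classes

variable {a a' : Cocycle Gal(SeparableClosure F/F) (A.ratPoints (SeparableClosure F))}
  {g g' : GL (Fin N) (SeparableClosure F)}

/-- Cohomology of coboundaries in terms of matrix entries. -/
theorem cohomologous_iff_entries (h : A.IsTwist a g) (h' : A.IsTwist a' g') :
    Cohomologous _ _ a a' ↔ ∃ c b : Fin N × Fin N → AlgebraicClosure F,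
      (∃ y, tupleMul c y = tupleOne) ∧ (∀ p, c p ∈ Set.range (algebraMap F (AlgebraicClosure F))) ∧
      A.IsPoint b ∧
      tupleMul c (entries (Matrix.GeneralLinearGroup.map
        (algebraMap (SeparableClosure F) (AlgebraicClosure F)) g')) =
      tupleMul (entries (Matrix.GeneralLinearGroup.map
        (algebraMap (SeparableClosure F) (AlgebraicClosure F)) g)) b := by
  rw [cohomologous_iff h h']
  constructor
  · rintro ⟨c, b, hcb⟩
    refine ⟨entries (Matrix.GeneralLinearGroup.map (algebraMap F (AlgebraicClosure F)) c),
      entries (Matrix.GeneralLinearGroup.map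
        (algebraMap (SeparableClosure F) (AlgebraicClosure F)) b.1),
      (exists_entries_eq_iff _).1 ⟨_, rfl⟩, fun p => ⟨entries c p, rfl⟩, ⟨_, b.2, rfl⟩, ?_⟩
    rw [← entries_mul, ← entries_mul, ← map_mul, ← hcb, map_mul]
    rfl
  · rintro ⟨c, b, hc, hcF, ⟨B, hB, rfl⟩, hcb⟩
    obtain ⟨C, rfl⟩ := (exists_entries_eq_iff c).2 hc
    obtain ⟨C, rfl⟩ := exists_map_eq_of_entries_mem_range (algebraMap F (AlgebraicClosure F)) C
      fun i j => hcF (i, j)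
    rw [← entries_mul, ← entries_mul] at hcb
    have hCB := entries_injective hcb
    rw [← inv_mul_eq_iff_eq_mul] at hCB
    have hC : Matrix.GeneralLinearGroup.map (algebraMap F (AlgebraicClosure F)) C =
        Matrix.GeneralLinearGroup.map (algebraMap (SeparableClosure F) (AlgebraicClosure F))
          (Matrix.GeneralLinearGroup.map (algebraMap F (SeparableClosure F)) C) := rfl
    rw [hC, ← map_mul, ← map_inv, ← map_mul] at hCB
    refine ⟨C, ⟨g⁻¹ * (Matrix.GeneralLinearGroup.map (algebraMap F (SeparableClosure F)) C * g'),
      ?_⟩, (mul_inv_cancel_left _ _).symm⟩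
    rw [ratPoints, Subgroup.mem_comap, hCB]
    exact hB

/-- The codes of cocycles in the class of a coboundary, in terms of matrix entries. -/
theorem exists_isTwistCode_iff (h : A.IsTwist a g) {d : ℕ} {β : AlgebraicClosure F}
    {α : Fin d → AlgebraicClosure F} {m : Fin d → Fin N → Fin N → AlgebraicClosure F} :
    (∃ x b, IsTwistCode A.IsPoint x β α m ∧ A.IsPoint b ∧ tupleMul x b =
      entries (Matrix.GeneralLinearGroup.map
        (algebraMap (SeparableClosure F) (AlgebraicClosure F)) g)) ↔
    ∃ (L : IntermediateField F (SeparableClosure F)) (_ : FiniteDimensional F L)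
      (_ : IsGalois F L) (a' : Cocycle Gal(L/F) (A.ratPoints L)),
      A.Codes a' β α m ∧ Cohomologous _ _ (A.inflCocycle L a') a := by
  constructor
  · rintro ⟨x, b, hx, ⟨B, hB, rfl⟩, hxb⟩
    obtain ⟨L, fd, gal, g', a', hga, hc, rfl⟩ := isTwistCode_iff.1 hx
    refine ⟨L, fd, gal, a', hc, (cohomologous_iff (isTwist_inflCocycle hga) h).2
      ⟨1, ⟨(Matrix.GeneralLinearGroup.map (algebraMap L (SeparableClosure F)) g')⁻¹ * g, ?_⟩, ?_⟩⟩
    · rw [← entries_mul] at hxb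
      have h1 := entries_injective hxb
      rw [← eq_inv_mul_iff_mul_eq] at h1
      rw [ratPoints, Subgroup.mem_comap, map_mul, map_inv]
      rw [h1] at hB
      exact hB
    · rw [map_one, one_mul, mul_inv_cancel_left]
  · rintro ⟨L, fd, gal, a', hc, hcoh⟩
    obtain ⟨g', hg'⟩ := hilbert90 (fun s => (a'.toFun s).1) (a'.locallyConstant.comp Subtype.val)
      fun s t => by
        rw [a'.map_mul]
        rfl
    obtain ⟨c, b, hcb⟩ := (cohomologous_iff (isTwist_inflCocycle hg') h).1 hcoh
    -- Multiplying g' on the left by a matrix over F does not change its coboundary. Hence c⁻¹ g'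
    -- still belongs to a', and it differs from g only by b on the right.
    have hc' : ∀ s : Gal(L/F), galMap s (Matrix.GeneralLinearGroup.map (algebraMap F L) c⁻¹) =
        Matrix.GeneralLinearGroup.map (algebraMap F L) c⁻¹ := fun s =>
      Units.ext (Matrix.ext fun i j => s.commutes _)
    refine ⟨_, entries (Matrix.GeneralLinearGroup.map
      (algebraMap (SeparableClosure F) (AlgebraicClosure F)) b.1), isTwistCode_iff.2 ⟨L, fd, gal,
      Matrix.GeneralLinearGroup.map (algebraMap F L) c⁻¹ * g', a', fun s => ?_, hc, rfl⟩,
      ⟨_, b.2, rfl⟩, ?_⟩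
    · rw [map_mul, hc', mul_assoc, hg']
    · have h1 : g = Matrix.GeneralLinearGroup.map (algebraMap L (SeparableClosure F))
          (Matrix.GeneralLinearGroup.map (algebraMap F L) c⁻¹ * g') * b.1 := by
        rw [map_mul, mul_assoc, ← hcb]
        change g = Matrix.GeneralLinearGroup.map (algebraMap F (SeparableClosure F)) c⁻¹ * _
        rw [map_inv, inv_mul_cancel_left]
      conv_rhs => rw [h1]
      rw [← entries_mul, (Matrix.GeneralLinearGroup.map
        (algebraMap (SeparableClosure F) (AlgebraicClosure F))).map_mul]
      rfl

end Classes

end LinearAlgebraicGroup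

end

end GalCoh

/-! ### Definability of the codes -/

namespace GalCoh

noncomputable section

variable {L : FirstOrder.Language.{u, v}}

namespace UDef

variable {ι κ : Type}

/-- Serves for conditions on indices alone, such as i = j in the injectivity of α. -/
theorem const (p : Prop) : UDef fun (M : FieldModel.{u, v, w} L) (_ : ι → M.K) => p := by
  by_cases hp : p
  · exact (UDef.false.imp UDef.false).congr fun M x => by simp [hp]
  · exact UDef.false.congr fun M x => by simp [hp]

theorem exBase [Finite κ] {P : (M : FieldModel.{u, v, w} L) → (ι → M.K) → (κ → M.K) → Prop}
    (hP : UDef (ι := ι ⊕ κ) fun M x => P M (fun i => x (Sum.inl i)) (fun k => x (Sum.inr k))) :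
    UDef fun M x => ∃ c : κ → M.F, P M x fun k => algebraMap M.F M.K (c k) := by
  refine (UDef.ex (P := fun M x (y : κ → M.K) =>
    (∀ k, y k ∈ Set.range (algebraMap M.F M.K)) ∧ P M x y)
    ((UDef.iAnd fun k => UDef.base (UTerm.var (Sum.inr k))).and hP)).congr fun M x => ?_
  constructor
  · rintro ⟨y, hy, h⟩
    choose c hc using hy
    obtain rfl := funext hc
    exact ⟨c, h⟩
  · rintro ⟨c, h⟩
    exact ⟨_, fun k => ⟨c k, rfl⟩, h⟩

theorem allBase [Finite κ] {P : (M : FieldModel.{u, v, w} L) → (ι → M.K) → (κ → M.K) → Prop}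
    (hP : UDef (ι := ι ⊕ κ) fun M x => P M (fun i => x (Sum.inl i)) (fun k => x (Sum.inr k))) :
    UDef fun M x => ∀ c : κ → M.F, P M x fun k => algebraMap M.F M.K (c k) := by
  refine (UDef.all (P := fun M x (y : κ → M.K) =>
    (∀ k, y k ∈ Set.range (algebraMap M.F M.K)) → P M x y)
    ((UDef.iAnd fun k => UDef.base (UTerm.var (Sum.inr k))).imp hP)).congr fun M x => ?_
  constructor
  · exact fun h c => h _ fun k => ⟨c k, rfl⟩
  · intro h y hy
    choose c hc using hy
    obtain rfl := funext hc
    exact h c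

theorem eqTuple [Finite κ] {f g : (M : FieldModel.{u, v, w} L) → (ι → M.K) → κ → M.K}
    (hf : ∀ k, UTerm fun M x => f M x k) (hg : ∀ k, UTerm fun M x => g M x k) :
    UDef fun M x => f M x = g M x :=
  (UDef.iAnd fun k => UDef.eq (hf k) (hg k)).congr fun _ _ => funext_iff.symm

end UDef

section

variable {ι : Type} {N d : ℕ}

theorem UTerm.tupleMul {f g : (M : FieldModel.{u, v, w} L) → (ι → M.K) → Fin N × Fin N → M.K}
    (hf : ∀ p, UTerm fun M x => f M x p) (hg : ∀ p, UTerm fun M x => g M x p) (p : Fin N × Fin N) :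
    UTerm fun M x => GalCoh.tupleMul (f M x) (g M x) p :=
  UTerm.sum _ fun t => (hf (p.1, t)).mul (hg (t, p.2))

theorem UTerm.tupleOne (p : Fin N × Fin N) :
    UTerm fun (M : FieldModel.{u, v, w} L) (_ : ι → M.K) => (GalCoh.tupleOne p : M.K) :=
  UTerm.ite _ UTerm.one UTerm.zero

theorem UDef.exists_tupleMul_eq_one : UDef fun (M : FieldModel.{u, v, w} L)
    (x : Fin N × Fin N → M.K) => ∃ y, tupleMul x y = tupleOne :=
  UDef.ex (P := fun M x (y : Fin N × Fin N → M.K) => tupleMul x y = tupleOne)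
    (UDef.eqTuple (UTerm.tupleMul (fun p => UTerm.var (Sum.inl p)) fun p => UTerm.var (Sum.inr p))
      UTerm.tupleOne)

theorem UTerm.sum_mul_pow {f : Fin d → (M : FieldModel.{u, v, w} L) → (ι → M.K) → M.K}
    {g : (M : FieldModel.{u, v, w} L) → (ι → M.K) → M.K} (hf : ∀ k, UTerm (f k)) (hg : UTerm g) :
    UTerm fun M x => ∑ k, f k M x * g M x ^ (k : ℕ) :=
  UTerm.sum _ fun k => (hf k).mul (hg.pow k)

theorem UDef.isGalCode : UDef fun (M : FieldModel.{u, v, w} L) (x : Unit ⊕ Fin d → M.K) =>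
    IsGalCode (x (Sum.inl ())) fun i => x (Sum.inr i) := by
  refine UDef.and ?_ (UDef.and ?_ (UDef.and ?_ (UDef.and ?_ ?_)))
  · exact UDef.iAnd fun i => UDef.iAnd fun j =>
      (UDef.eq (UTerm.var (Sum.inr i)) (UTerm.var (Sum.inr j))).imp (UDef.const _)
  · exact UDef.iOr fun i => UDef.eq (UTerm.var _) (UTerm.var (Sum.inr i))
  · exact UDef.iAnd fun i => UDef.exBase (P := fun M x (r : Fin d → M.K) =>
      x (Sum.inr i) = ∑ k, r k * x (Sum.inl ()) ^ (k : ℕ))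
      (UDef.eq (UTerm.var _) (UTerm.sum_mul_pow (fun k => UTerm.var (Sum.inr k)) (UTerm.var _)))
  · exact UDef.exBase (P := fun M x (c : Fin d → M.K) =>
      ∀ i, x (Sum.inr i) ^ d + ∑ k, c k * x (Sum.inr i) ^ (k : ℕ) = 0)
      (UDef.iAnd fun i => UDef.eq (((UTerm.var _).pow d).add
        (UTerm.sum_mul_pow (fun k => UTerm.var (Sum.inr k)) (UTerm.var _))) UTerm.zero)
  · refine (UDef.allBase (P := fun M x (r : Fin d → M.K) =>
      ∑ k, r k * x (Sum.inl ()) ^ (k : ℕ) = 0 → ∀ k, r k = 0)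
      ((UDef.eq (UTerm.sum_mul_pow (fun k => UTerm.var (Sum.inr k)) (UTerm.var _)) UTerm.zero).imp
        (UDef.iAnd fun k => UDef.eq (UTerm.var (Sum.inr k)) UTerm.zero))).congr fun M x => ?_
    simp only [map_eq_zero]

theorem UDef.isTwistCode {S : (M : FieldModel.{u, v, w} L) → (Fin N × Fin N → M.K) → Prop}
    (hS : UDef S) : UDef fun (M : FieldModel.{u, v, w} L)
      (x : (Fin N × Fin N) ⊕ CodeIdx N d → M.K) =>
      IsTwistCode (S M) (fun p => x (Sum.inl p)) (x (Sum.inr (Sum.inl ())))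
        (fun i => x (Sum.inr (Sum.inr (Sum.inl i))))
        (fun i j k => x (Sum.inr (Sum.inr (Sum.inr (i, j, k))))) := by
  refine UDef.and ?_ (UDef.and ?_ (UDef.and ?_ ?_))
  · exact UDef.isGalCode.comp (f := fun i M x => x (Sum.inr (Sum.elim Sum.inl
      (fun j => Sum.inr (Sum.inl j)) i))) fun i => UTerm.var _
  · exact UDef.exists_tupleMul_eq_one.comp (f := fun p M x => x (Sum.inl p)) fun p => UTerm.var _
  · exact UDef.iAnd fun i => hS.comp
      (f := fun p M x => x (Sum.inr (Sum.inr (Sum.inr (i, p.1, p.2))))) fun p => UTerm.var _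
  · exact UDef.iAnd fun p => UDef.exBase (P := fun M x (r : Fin d → M.K) =>
      x (Sum.inl p) = ∑ k, r k * x (Sum.inr (Sum.inl ())) ^ (k : ℕ) ∧
      ∀ i, ∑ k, r k * x (Sum.inr (Sum.inr (Sum.inl i))) ^ (k : ℕ) =
        tupleMul (fun p => x (Sum.inl p))
          (fun q => x (Sum.inr (Sum.inr (Sum.inr (i, q.1, q.2))))) p)
      ((UDef.eq (UTerm.var _) (UTerm.sum_mul_pow (fun k => UTerm.var (Sum.inr k)) (UTerm.var _))).and
        (UDef.iAnd fun i => UDef.eq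
          (UTerm.sum_mul_pow (fun k => UTerm.var (Sum.inr k)) (UTerm.var _))
          (UTerm.tupleMul (fun _ => UTerm.var _) (fun _ => UTerm.var _) p)))

/-- The points of the group given by the equations `f = 0`, where the parameters satisfy `θ`. -/
def DefinedPoint {m r : ℕ} (θ : (FirstOrder.Language.ring.sum L).Formula (Fin m))
    (f : Fin r → MvPolynomial (ParamIdx N m) ℤ) (M : FieldModel.{u, v, w} L)
    (x : Fin N × Fin N → M.K) : Prop :=
  (∃ y : Fin m → M.K, (∃ c : Fin m → M.F, (y = fun i => algebraMap M.F M.K (c i)) ∧ θ.Realize c) ∧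
    ∀ j, MvPolynomial.aeval (Sum.elim x y) (f j) = 0) ∧ ∃ y, tupleMul x y = tupleOne

theorem UDef.definedPoint {m r : ℕ} (θ : (FirstOrder.Language.ring.sum L).Formula (Fin m))
    (f : Fin r → MvPolynomial (ParamIdx N m) ℤ) : UDef (DefinedPoint.{u, v, w} θ f) := by
  refine UDef.and (UDef.ex (P := fun M x (y : Fin m → M.K) =>
    (∃ c : Fin m → M.F, (y = fun i => algebraMap M.F M.K (c i)) ∧ θ.Realize c) ∧
    ∀ j, MvPolynomial.aeval (Sum.elim x y) (f j) = 0) (UDef.and ?_ ?_)) UDef.exists_tupleMul_eq_one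
  · exact (BaseDef.formula θ).toUDef.comp (f := fun k M x => x (Sum.inr k)) fun k => UTerm.var _
  · refine UDef.iAnd fun j => UDef.eq (UTerm.aeval (f j) ?_) UTerm.zero
    rintro (p | k)
    exacts [UTerm.var (Sum.inl p), UTerm.var (Sum.inr k)]

theorem LinearAlgebraicGroup.CutOut.definedPoint_iff {m r : ℕ}
    {θ : (FirstOrder.Language.ring.sum L).Formula (Fin m)}
    {f : Fin r → MvPolynomial (ParamIdx N m) ℤ} (M : FieldModel.{u, v, w} L)
    {A : LinearAlgebraicGroup M.F N} {c : Fin m → M.F} (hc : ∀ c', θ.Realize c' ↔ c' = c)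
    (hA : A.CutOut f c) (x : Fin N × Fin N → M.K) : DefinedPoint θ f M x ↔ A.IsPoint x := by
  constructor
  · rintro ⟨⟨_, ⟨c', rfl, hc'⟩, hf⟩, hx⟩
    obtain rfl := (hc c').1 hc'
    obtain ⟨g, rfl⟩ := (exists_entries_eq_iff x).2 hx
    exact ⟨g, (hA g).2 hf, rfl⟩
  · rintro ⟨g, hg, rfl⟩
    exact ⟨⟨_, ⟨c, rfl, (hc c).2 rfl⟩, (hA g).1 hg⟩, (exists_entries_eq_iff _).1 ⟨g, rfl⟩⟩

end

end

end GalCoh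

/-! ### Definability of the first cohomology -/

namespace GalCoh

noncomputable section

variable {L : FirstOrder.Language.{u, v}}

section

variable {N m r : ℕ}

/-- A matrix given by a tuple of length `N * N`. -/
def unflatten {N : ℕ} {E : Type*} (x : Fin (N * N) → E) : Fin N × Fin N → E :=
  fun p => x (finProdFinEquiv p)

theorem exists_unflatten_eq {N : ℕ} {E : Type*} (y : Fin N × Fin N → E) :
    ∃ x, unflatten x = y :=
  ⟨fun i => y (finProdFinEquiv.symm i), funext fun p =>
    congrArg y (finProdFinEquiv.symm_apply_apply p)⟩

variable {S : (M : FieldModel.{u, v, w} L) → (Fin N × Fin N → M.K) → Prop}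

theorem UDef.exists_isTwistCode (hS : UDef S) (B : ℕ) :
    UDef fun (M : FieldModel.{u, v, w} L) (x : Fin (N * N) → M.K) =>
      ∃ (d : Fin B) (z : CodeIdx N d → M.K), IsTwistCode (S M) (unflatten x) (z (Sum.inl ()))
        (fun i => z (Sum.inr (Sum.inl i))) (fun i j k => z (Sum.inr (Sum.inr (i, j, k)))) :=
  UDef.iOr fun d => UDef.ex (P := fun M x (z : CodeIdx N d → M.K) =>
    IsTwistCode (S M) (unflatten x) (z (Sum.inl ()))
      (fun i => z (Sum.inr (Sum.inl i))) (fun i j k => z (Sum.inr (Sum.inr (i, j, k)))))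
    ((UDef.isTwistCode hS).comp
      (f := fun i _ x => x (Sum.map (fun p => finProdFinEquiv p) id i)) fun _ => UTerm.var _)

theorem UDef.exists_mul_eq_mul (hS : UDef S) :
    UDef fun (M : FieldModel.{u, v, w} L) (x : Fin (N * N) ⊕ Fin (N * N) → M.K) =>
      ∃ c b : Fin N × Fin N → M.K, (∃ y, tupleMul c y = tupleOne) ∧
        (∀ p, c p ∈ Set.range (algebraMap M.F M.K)) ∧ S M b ∧
        tupleMul c (unflatten fun i => x (Sum.inr i)) =
          tupleMul (unflatten fun i => x (Sum.inl i)) b := by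
  refine UDef.ex (P := fun M x (c : Fin N × Fin N → M.K) => ∃ b : Fin N × Fin N → M.K,
    (∃ y, tupleMul c y = tupleOne) ∧
        (∀ p, c p ∈ Set.range (algebraMap M.F M.K)) ∧ S M b ∧
        tupleMul c (unflatten fun i => x (Sum.inr i)) =
          tupleMul (unflatten fun i => x (Sum.inl i)) b) ?_
  refine UDef.ex (P := fun M (x : (Fin (N * N) ⊕ Fin (N * N)) ⊕ Fin N × Fin N → M.K)
    (b : Fin N × Fin N → M.K) => (∃ y, tupleMul (fun p => x (Sum.inr p)) y = tupleOne) ∧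
      (∀ p, x (Sum.inr p) ∈ Set.range (algebraMap M.F M.K)) ∧ S M b ∧
      tupleMul (fun p => x (Sum.inr p)) (unflatten fun i => x (Sum.inl (Sum.inr i))) =
        tupleMul (unflatten fun i => x (Sum.inl (Sum.inl i))) b) ?_
  refine UDef.and ?_ (UDef.and ?_ (UDef.and ?_ ?_))
  · exact UDef.exists_tupleMul_eq_one.comp (f := fun p M x => x (Sum.inl (Sum.inr p)))
      fun p => UTerm.var _
  · exact UDef.iAnd fun p => UDef.base (UTerm.var _)
  · exact hS.comp (f := fun p M x => x (Sum.inr p)) fun p => UTerm.var _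
  · exact UDef.eqTuple (UTerm.tupleMul (fun _ => UTerm.var _) fun _ => UTerm.var _)
      (UTerm.tupleMul (fun _ => UTerm.var _) fun _ => UTerm.var _)

theorem UDef.exists_isTwistCode_mul (hS : UDef S) (d : ℕ) :
    UDef fun (M : FieldModel.{u, v, w} L) (x : Fin (N * N) ⊕ CodeIdx N d → M.K) =>
      ∃ h b : Fin N × Fin N → M.K, IsTwistCode (S M) h (x (Sum.inr (Sum.inl ())))
        (fun i => x (Sum.inr (Sum.inr (Sum.inl i))))
        (fun i j k => x (Sum.inr (Sum.inr (Sum.inr (i, j, k))))) ∧ S M b ∧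
        tupleMul h b = unflatten fun i => x (Sum.inl i) := by
  refine UDef.ex (P := fun M x (h : Fin N × Fin N → M.K) => ∃ b : Fin N × Fin N → M.K,
    IsTwistCode (S M) h (x (Sum.inr (Sum.inl ())))
        (fun i => x (Sum.inr (Sum.inr (Sum.inl i))))
        (fun i j k => x (Sum.inr (Sum.inr (Sum.inr (i, j, k))))) ∧ S M b ∧
        tupleMul h b = unflatten fun i => x (Sum.inl i)) ?_
  refine UDef.ex (P := fun M (x : (Fin (N * N) ⊕ CodeIdx N d) ⊕ Fin N × Fin N → M.K)
    (b : Fin N × Fin N → M.K) => IsTwistCode (S M) (fun p => x (Sum.inr p))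
        (x (Sum.inl (Sum.inr (Sum.inl ()))))
        (fun i => x (Sum.inl (Sum.inr (Sum.inr (Sum.inl i)))))
        (fun i j k => x (Sum.inl (Sum.inr (Sum.inr (Sum.inr (i, j, k)))))) ∧ S M b ∧
        tupleMul (fun p => x (Sum.inr p)) b = unflatten fun i => x (Sum.inl (Sum.inl i))) ?_
  refine UDef.and ?_ (UDef.and ?_ ?_)
  · exact (UDef.isTwistCode hS).comp (f := fun i M x => x (Sum.inl
      (Sum.elim (fun p => Sum.inr p) (fun z => Sum.inl (Sum.inr z)) i))) fun _ => UTerm.var _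
  · exact hS.comp (f := fun p M x => x (Sum.inr p)) fun p => UTerm.var _
  · exact UDef.eqTuple (UTerm.tupleMul (fun _ => UTerm.var _) fun _ => UTerm.var _)
      fun _ => UTerm.var _

end

/-- The cohomology class of a matrix which has a code. -/
theorem LinearAlgebraicGroup.exists_class_map {F : Type w} [Field F] {N B : ℕ}
    (A : LinearAlgebraicGroup F N)
    (hB : ∀ a : Cocycle Gal(SeparableClosure F/F) (A.ratPoints (SeparableClosure F)),
      ∃ (L : IntermediateField F (SeparableClosure F)) (_ : FiniteDimensional F L)
        (_ : IsGalois F L) (g : GL (Fin N) L)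
        (a' : Cocycle Gal(SeparableClosure F/F) (A.ratPoints (SeparableClosure F))),
        Module.finrank F L ≤ B ∧ Cohomologous _ _ a a' ∧
          A.IsTwist a' (Matrix.GeneralLinearGroup.map (algebraMap L (SeparableClosure F)) g))
    {P : (Fin (N * N) → AlgebraicClosure F) → Prop}
    (hP : ∀ x, P x ↔ ∃ (d : Fin (B + 1)) (z : CodeIdx N d → AlgebraicClosure F),
      IsTwistCode A.IsPoint (unflatten x) (z (Sum.inl ()))
        (fun i => z (Sum.inr (Sum.inl i))) (fun i j k => z (Sum.inr (Sum.inr (i, j, k))))) :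
    ∃ Φ : {x // P x} → A.galH1, Function.Surjective Φ ∧
      (∀ x y, (∃ c b : Fin N × Fin N → AlgebraicClosure F, (∃ y, tupleMul c y = tupleOne) ∧
        (∀ p, c p ∈ Set.range (algebraMap F (AlgebraicClosure F))) ∧ A.IsPoint b ∧
        tupleMul c (unflatten y.1) = tupleMul (unflatten x.1) b) ↔ Φ x = Φ y) ∧
      ∀ (d : ℕ) x (β : AlgebraicClosure F) (α : Fin d → AlgebraicClosure F)
        (m : Fin d → Fin N → Fin N → AlgebraicClosure F),
        (∃ h b, IsTwistCode A.IsPoint h β α m ∧ A.IsPoint b ∧ tupleMul h b = unflatten x.1) ↔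
          ∃ (L : IntermediateField F (SeparableClosure F)) (_ : FiniteDimensional F L)
            (_ : IsGalois F L) (a : Cocycle Gal(L/F) (A.ratPoints L)),
            A.Codes a β α m ∧ A.infl L (Quotient.mk (cocycleSetoid _ _) a) = Φ x := by
  have h1 : ∀ x : {x // P x}, ∃ g a, A.IsTwist a g ∧ unflatten x.1 =
      entries (Matrix.GeneralLinearGroup.map
        (algebraMap (SeparableClosure F) (AlgebraicClosure F)) g) := fun x => by
    obtain ⟨d, z, hz⟩ := (hP x.1).1 x.2
    exact exists_isTwist_of_isTwistCode hz
  -- The choice is harmless: the tuple determines g, and g determines its cocycle.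
  choose g a ha hg using h1
  refine ⟨fun x => Quotient.mk (cocycleSetoid _ _) (a x), fun ξ => ?_, fun x y => ?_,
    fun d x β α m => ?_⟩
  · obtain ⟨a₀, rfl⟩ := Quotient.exists_rep ξ
    obtain ⟨L', fd, gal, g', a', hle, hcoh, ha'⟩ := hB a₀
    obtain ⟨b, hb, -⟩ := ha'.exists_inflCocycle_eq
    obtain ⟨β, α, m, hc⟩ := exists_codes b
    obtain ⟨x, hx⟩ := exists_unflatten_eq (entries (Matrix.GeneralLinearGroup.map
      (algebraMap L' (AlgebraicClosure F)) g'))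
    refine ⟨⟨x, (hP x).2 ⟨⟨_, Nat.lt_succ_of_le hle⟩, codeTuple β α m,
      isTwistCode_iff.2 ⟨L', fd, gal, g', b, hb, hc, hx⟩⟩⟩, ?_⟩
    refine Quotient.sound ?_
    have h2 := ha ⟨x, (hP x).2 ⟨⟨_, Nat.lt_succ_of_le hle⟩, codeTuple β α m,
      isTwistCode_iff.2 ⟨L', fd, gal, g', b, hb, hc, hx⟩⟩⟩
    have h3 := (hg ⟨x, (hP x).2 ⟨⟨_, Nat.lt_succ_of_le hle⟩, codeTuple β α m,
      isTwistCode_iff.2 ⟨L', fd, gal, g', b, hb, hc, hx⟩⟩⟩).symm.trans hx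
    -- The matrix chosen for x has the same entries as g', so its cocycle is a'.
    rw [map_injective (algebraMap (SeparableClosure F) (AlgebraicClosure F))
      (entries_injective h3 : _ = Matrix.GeneralLinearGroup.map
        (algebraMap (SeparableClosure F) (AlgebraicClosure F))
        (Matrix.GeneralLinearGroup.map (algebraMap L' (SeparableClosure F)) g'))] at h2
    rw [h2.eq ha']
    exact (cocycleSetoid _ _).symm hcoh
  · rw [hg, hg, ← cohomologous_iff_entries (ha x) (ha y)]
    exact (Quotient.eq (r := cocycleSetoid _ _)).symm
  · rw [hg, exists_isTwistCode_iff (ha x)]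
    refine exists_congr fun L' => exists_congr fun _ => exists_congr fun _ => exists_congr fun b =>
      and_congr_right fun _ => ?_
    exact (Quotient.eq (r := cocycleSetoid _ _)).symm

theorem DefinableGroup.h1Definable {T : (FirstOrder.Language.ring.sum L).Theory}
    (A : DefinableGroup.{u, v, w} T) : H1Definable A := by
  obtain ⟨m, r, θ, f, hA⟩ := A.uniform
  obtain ⟨B, hB⟩ := exists_bound_twist.{w} f
  have hS := UDef.definedPoint.{u, v, w} θ f
  -- Degrees range over `Fin (B + 1)`, so that degree B is included.
  obtain ⟨D, hD⟩ := hS.exists_isTwistCode (B + 1)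
  obtain ⟨E, hE⟩ := hS.exists_mul_eq_mul
  choose R hR using hS.exists_isTwistCode_mul
  refine ⟨A.N * A.N, D, E, R, ?_⟩
  intro F _ _ _ _
  obtain ⟨c, hc, hcut⟩ := hA F
  let M : FieldModel.{u, v, w} L := ⟨F⟩
  -- The formula θ has c as its only solution, so the parameter-free description gives exactly the
  -- points of A.
  have hS' : DefinedPoint θ f M = (A.group F).IsPoint := funext fun x =>
    propext (LinearAlgebraicGroup.CutOut.definedPoint_iff M hc hcut x)
  have hDM := hD M
  have hEM := hE M
  have hRM := fun d => hR d M
  simp only [hS'] at hDM hEM hRM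
  obtain ⟨Φ, hΦ, hΦE, hΦR⟩ := (A.group F).exists_class_map (hB F (A.group F) c hcut) hDM
  exact ⟨Φ, hΦ, fun x y => (hEM (Sum.elim x.1 y.1)).trans (hΦE x y),
    fun d x β α m => (hRM d (Sum.elim x.1 (codeTuple β α m))).trans (hΦR d x β α m)⟩

theorem DefinableGroup.exists_splitClasses_eq_univ
    {T : (FirstOrder.Language.ring.sum L).Theory} (A : DefinableGroup.{u, v, w} T) :
    ∃ n : ℕ, 0 < n ∧ ∀ (F : Type w) [Field F] [CompatibleRing F] [L.Structure F] [F ⊨ T],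
      (A.group F).splitClasses n = Set.univ := by
  obtain ⟨m, r, θ, f, hA⟩ := A.uniform
  obtain ⟨B, hB⟩ := exists_bound_twist.{w} f
  -- Every positive degree at most B divides B!.
  refine ⟨B.factorial, B.factorial_pos, ?_⟩
  intro F _ _ _ _
  obtain ⟨c, -, hcut⟩ := hA F
  refine Set.eq_univ_of_forall fun ξ => ?_
  obtain ⟨a, rfl⟩ := Quotient.exists_rep ξ
  obtain ⟨L', fd, gal, g, a', hle, hcoh, ha'⟩ := hB F (A.group F) c hcut a
  obtain ⟨b, -, hb⟩ := ha'.exists_inflCocycle_eq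
  refine ⟨L', fd, gal, Nat.dvd_factorial Module.finrank_pos hle, Quotient.mk _ b, ?_⟩
  refine (Quotient.sound ?_ : Quotient.mk (cocycleSetoid _ _) ((A.group F).inflCocycle L' b) = _)
  rw [hb]
  exact (cocycleSetoid _ _).symm hcoh

end

end GalCoh

theorem mainTheorem9 {L : FirstOrder.Language.{u, v}}
    (T : (FirstOrder.Language.ring.sum L).Theory) (A : GalCoh.DefinableGroup.{u, v, w} T) :
    GalCoh.H1Definable A ∧
    ∃ n : ℕ, 0 < n ∧
      ∀ (F : Type w) [Field F] [FirstOrder.Ring.CompatibleRing F] [L.Structure F] [F ⊨ T],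
        (A.group F).splitClasses n = Set.univ :=
  ⟨A.h1Definable, A.exists_splitClasses_eq_univ⟩
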